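/- Let $\mathcal{M}=(\mathcal{S},\mathcal{A},\mathcal{R},p)$ be a finite Markov decision process with real rewards and let $\mathcal{O}$ be a finite set of options; an option $o$ has a policy $\pi(\cdot\mid s,o)$ and termination probabilities $\beta(s,o)\in[0,1]$, and may be initiated in every state. An execution of $o$ from $s$ repeatedly draws an action from $\pi(\cdot\mid\cdot,o)$ and a next state and reward from $p$, and on each arrival in a state $s'$ terminates with probability $\beta(s',o)$. Let $\hat p(s',r,l\mid s,o)$ be the probability that an execution of $o$ from $s$ terminates in $s'$ after exactly $l\ge 1$ steps with cumulative reward $r$. Assume that the execution time of every option from every state is almost surely finite and has finite expectation, and let $$m^p(x\mid s,o)=\sum_{r,l}\hat p(x,r,l\mid s,o),\qquad m^r(s,o)=\sum_{s',r,l}\hat p(s',r,l\mid s,o)\,r,\qquad m^l(s,o)=\sum_{s',r,l}\hat p(s',r,l\mid s,o)\,l .$$ Let $S_t,O_t,A_t,R_{t+1},S_{t+1},\dots$ ($t\ge 0$) be a stream of experience on a probability space with a filtration $(\mathcal{F}_t)$: $S_t,O_t$ are $\mathcal{F}_t$-measurable, $A_t,R_{t+1}$ are $\mathcal{F}_{t+1}$-measurable,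 and given $\mathcal{F}_t$ the triple $(A_t,S_{t+1},R_{t+1})$ equals $(a,s',r)$ with probability $\pi(a\mid S_t,O_t)\,p(s',r\mid S_t,a)$; the way in which the executed options $O_t$ are selected is otherwise arbitrary. Let $\rho_t(o)=\pi(A_t\mid S_t,o)/\pi(A_t\mid S_t,O_t)$. For each state-option pair let $\alpha_t(s,o)$, $t\ge0$, be $\mathcal{F}_t$-measurable step sizes such that, almost surely, for all $s,o$: $0\le\alpha_t(s,o)\le1$, $\sum_t\alpha_t(s,o)=\infty$, $\sum_t\alpha_t(s,o)^2<\infty$, and $\alpha_t(s,o)=0$ unless $s=S_t$ (hence every state-option pair is updated infinitely often). Assume also that, almost surely, whenever $\alpha_t(S_t,o)\ne0$, every action $a$ with $\pi(a\mid S_t,o)>0$ satisfies $\pi(a\mid S_t,O_t)>0$. Starting from arbitrary initial estimates $M^p_0,M^r_0,M^l_0$, for every $t$, every $o\in\mathcal{O}$ and every $x\in\mathcal{S}$ update $$M^p_{t+1}(x\mid S_t,o)=M^p_t(x\mid S_t,o)+\alpha_t(S_t,o)\rho_t(o)\Big(\beta(S_{t+1},o)\mathbb{I}(S_{t+1}=x)+(1-\beta(S_{t+1},o))M^p_t(x\mid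 S_{t+1},o)-M^p_t(x\mid S_t,o)\Big),$$ $$M^r_{t+1}(S_t,o)=M^r_t(S_t,o)+\alpha_t(S_t,o)\rho_t(o)\Big(R_{t+1}+(1-\beta(S_{t+1},o))M^r_t(S_{t+1},o)-M^r_t(S_t,o)\Big),$$ $$M^l_{t+1}(S_t,o)=M^l_t(S_t,o)+\alpha_t(S_t,o)\rho_t(o)\Big(1+(1-\beta(S_{t+1},o))M^l_t(S_{t+1},o)-M^l_t(S_t,o)\Big),$$ and leave all other entries unchanged. Then, almost surely, for all $s,x\in\mathcal{S}$ and $o\in\mathcal{O}$, as $t\to\infty$, $$M^p_t(x\mid s,o)\to m^p(x\mid s,o),\qquad M^r_t(s,o)\to m^r(s,o),\qquad M^l_t(s,o)\to m^l(s,o).$$ -/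

import Mathlib

open MeasureTheory Filter Topology

noncomputable section

/-- A finite Markov decision process with state type `S`, action type `A` (both taken finite),
a finite set of real rewards, and dynamics `p s' r s a = p(s', r | s, a)`. -/
structure FiniteMDP (S A : Type*) [Fintype S] where
  /-- the set of rewards -/
  rewards : Finset ℝ
  /-- `p s' r s a` is the probability of next state `s'` and reward `r` after action `a` in `s` -/
  p : S → rewards → S → A → ℝ
  p_nonneg : ∀ s' r s a, 0 ≤ p s' r s a
  p_sum : ∀ s a, ∑ s', ∑ r, p s' r s a = 1

/-- An option (initiable in every state): a stationary stochastic policy `policy a s = π(a | s, o)`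
and a termination probability `termination s = β(s, o)`. -/
structure MDPOption (S A : Type*) [Fintype A] where
  /-- `policy a s` is the probability of choosing action `a` in state `s` -/
  policy : A → S → ℝ
  policy_nonneg : ∀ a s, 0 ≤ policy a s
  policy_sum : ∀ s, ∑ a, policy a s = 1
  /-- the probability that the option terminates on arrival in a state -/
  termination : S → ℝ
  termination_nonneg : ∀ s, 0 ≤ termination s
  termination_le_one : ∀ s, termination s ≤ 1

section OptionModel

variable {S A : Type*} [Fintype S] [Fintype A]

/-- The probability that an execution of the option `o` started in `x 0` passes through the states
`x 0, x 1, …, x (n + 1)` with actions `a 0, …, a n` and rewards `u 0, …, u n`, does not terminate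
in `x 1, …, x n`, and terminates in `x (n + 1)`. -/
def executionProb (M : FiniteMDP S A) (o : MDPOption S A) (n : ℕ)
    (x : Fin (n + 2) → S) (a : Fin (n + 1) → A) (u : Fin (n + 1) → M.rewards) : ℝ :=
  (∏ i : Fin (n + 1), o.policy (a i) (x i.castSucc) * M.p (x i.succ) (u i) (x i.castSucc) (a i)) *
    (∏ i : Fin n, (1 - o.termination (x i.succ.castSucc))) * o.termination (x (Fin.last (n + 1)))

open Classical in
/-- The option transition probability `p̂(s', r, l | s, o)`: the probability that the option `o`
started in `s` terminates in `s'` after exactly `l` steps with cumulative reward `r`. -/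
def optionTransitionProb (M : FiniteMDP S A) (o : MDPOption S A) (s s' : S) (r : ℝ) : ℕ → ℝ
  | 0 => 0
  | n + 1 =>
    ∑ x : Fin (n + 2) → S, ∑ a : Fin (n + 1) → A, ∑ u : Fin (n + 1) → M.rewards,
      if x 0 = s ∧ x (Fin.last (n + 1)) = s' ∧ ∑ i, (u i : ℝ) = r then
        executionProb M o n x a u
      else 0

/-- The execution time of the option `o` started in `s` has finite expectation: it is almost surely
finite (the option transition probabilities sum to one) and the series of its mean converges. -/
def FiniteExpectedDuration (M : FiniteMDP S A) (o : MDPOption S A) (s : S) : Prop :=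
  HasSum (fun z : S × ℝ × ℕ => optionTransitionProb M o s z.1 z.2.1 z.2.2) 1 ∧
    Summable fun z : S × ℝ × ℕ => optionTransitionProb M o s z.1 z.2.1 z.2.2 * (z.2.2 : ℝ)

/-- The dynamics part `m^p(s' | s, o)`: the probability that `o` started in `s` terminates
in `s'`. -/
def dynamicsModel (M : FiniteMDP S A) (o : MDPOption S A) (s' s : S) : ℝ :=
  ∑' z : ℝ × ℕ, optionTransitionProb M o s s' z.1 z.2

/-- The reward part `m^r(s, o)`: the expected cumulative reward of `o` started in `s`. -/
def rewardModel (M : FiniteMDP S A) (o : MDPOption S A) (s : S) : ℝ :=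
  ∑' z : S × ℝ × ℕ, optionTransitionProb M o s z.1 z.2.1 z.2.2 * z.2.1

/-- The duration part `m^l(s, o)`: the expected duration of `o` started in `s`. -/
def durationModel (M : FiniteMDP S A) (o : MDPOption S A) (s : S) : ℝ :=
  ∑' z : S × ℝ × ℕ, optionTransitionProb M o s z.1 z.2.1 z.2.2 * (z.2.2 : ℝ)

lemma executionProb_nonneg (M : FiniteMDP S A) (o : MDPOption S A) (n : ℕ)
    (x : Fin (n + 2) → S) (a : Fin (n + 1) → A) (u : Fin (n + 1) → M.rewards) :
    0 ≤ executionProb M o n x a u :=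
  mul_nonneg (mul_nonneg
    (Finset.prod_nonneg fun _ _ => mul_nonneg (o.policy_nonneg _ _) (M.p_nonneg _ _ _ _))
    (Finset.prod_nonneg fun _ _ => sub_nonneg.2 (o.termination_le_one _)))
    (o.termination_nonneg _)

lemma optionTransitionProb_nonneg (M : FiniteMDP S A) (o : MDPOption S A) (s s' : S) (r : ℝ)
    (l : ℕ) : 0 ≤ optionTransitionProb M o s s' r l := by
  cases l with
  | zero => simp [optionTransitionProb]
  | succ n =>
    simp only [optionTransitionProb]
    refine Finset.sum_nonneg fun x _ => Finset.sum_nonneg fun a _ => Finset.sum_nonneg fun u _ => ?_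
    split_ifs
    · exact executionProb_nonneg M o n x a u
    · exact le_rfl

/-- The series that defines the reward part converges absolutely. -/
lemma summable_rewardModel (M : FiniteMDP S A) (o : MDPOption S A) (s : S)
    (h : FiniteExpectedDuration M o s) :
    Summable fun z : S × ℝ × ℕ => optionTransitionProb M o s z.1 z.2.1 z.2.2 * z.2.1 := by
  set C : ℝ := ∑ r ∈ M.rewards, |r| with hC
  have key : ∀ s' r l, optionTransitionProb M o s s' r l ≠ 0 → |r| ≤ C * (l : ℝ) := by
    intro s' r l hne
    cases l with
    | zero => simp [optionTransitionProb] at hne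
    | succ n =>
      simp only [optionTransitionProb] at hne
      obtain ⟨x, -, hx⟩ := Finset.exists_ne_zero_of_sum_ne_zero hne
      obtain ⟨a, -, ha⟩ := Finset.exists_ne_zero_of_sum_ne_zero hx
      obtain ⟨u, -, hu⟩ := Finset.exists_ne_zero_of_sum_ne_zero ha
      have hr : ∑ i, (u i : ℝ) = r := by
        by_contra hcon
        exact hu (if_neg fun hh => hcon hh.2.2)
      rw [← hr]
      calc |∑ i, (u i : ℝ)| ≤ ∑ i, |(u i : ℝ)| := Finset.abs_sum_le_sum_abs _ _
        _ ≤ ∑ _i : Fin (n + 1), C := Finset.sum_le_sum fun i _ =>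
            Finset.single_le_sum (f := fun r : ℝ => |r|) (fun r _ => abs_nonneg r) (u i).2
        _ = C * ((n + 1 : ℕ) : ℝ) := by simp [mul_comm]
  refine Summable.of_norm_bounded (h.2.mul_left C) fun z => ?_
  have h0 := optionTransitionProb_nonneg M o s z.1 z.2.1 z.2.2
  rw [Real.norm_eq_abs, abs_mul, abs_of_nonneg h0]
  by_cases hz : optionTransitionProb M o s z.1 z.2.1 z.2.2 = 0
  · simp [hz]
  · have := mul_le_mul_of_nonneg_left (key _ _ _ hz) h0
    linarith

end OptionModel

section Experience

variable {S A O Ω : Type*} [Fintype S] [Fintype A] [Fintype O] [MeasurableSpace Ω]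

/-- A stream of experience `S_t, O_t, A_t, R_{t+1}, S_{t+1}, …` generated by executing options:
the state `S_t` and the executed option `O_t` are known at time `t`, and given everything known at
time `t`, the action `A_t` is drawn from `π(· | S_t, O_t)` and then the next state and reward from
`p(·, · | S_t, A_t)`.  How the executed option is selected (when the current one ends and which one
comes next) is left arbitrary, as long as it does not look into the future. -/
structure IsExperience (P : Measure Ω) (ℱ : Filtration ℕ (inferInstance : MeasurableSpace Ω))
    (M : FiniteMDP S A) (opts : O → MDPOption S A)
    (St : ℕ → Ω → S) (Ot : ℕ → Ω → O) (At : ℕ → Ω → A) (Rt : ℕ → Ω → ℝ) : Prop where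
  measurable_state : ∀ t, Measurable[ℱ t, ⊤] (St t)
  measurable_option : ∀ t, Measurable[ℱ t, ⊤] (Ot t)
  measurable_action : ∀ t, Measurable[ℱ (t + 1), ⊤] (At t)
  measurable_reward : ∀ t, Measurable[ℱ (t + 1)] (Rt (t + 1))
  transition : ∀ (t : ℕ) (a : A) (s' : S) (r : M.rewards),
    P[Set.indicator {ω | At t ω = a ∧ St (t + 1) ω = s' ∧ Rt (t + 1) ω = (r : ℝ)}
        (fun _ => (1 : ℝ)) | ℱ t]
      =ᵐ[P] fun ω => (opts (Ot t ω)).policy a (St t ω) * M.p s' r (St t ω) a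

end Experience

section Algorithm

variable {S A O : Type*} [Fintype A]

/-- The importance sampling ratio `π(a | s, o) / π(a | s, o')`, with `o'` the executed option. -/
def importanceRatio (opts : O → MDPOption S A) (a : A) (s : S) (o o' : O) : ℝ :=
  (opts o).policy a s / (opts o').policy a s

open Classical in
/-- The estimates `M^p_t(x | s, o)` along a trajectory `st, ot, act` of states, executed options and
actions, with step sizes `α t s o` and initial estimate `M₀`: at time `t` the entries
`(x | S_t, o)`, for all `x` and `o`, are updated and the other entries stay the same. -/
def dynamicsEstimate (opts : O → MDPOption S A) (α : ℕ → S → O → ℝ)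
    (st : ℕ → S) (ot : ℕ → O) (act : ℕ → A) (M₀ : S → S → O → ℝ) : ℕ → S → S → O → ℝ
  | 0 => M₀
  | t + 1 => fun x s o =>
    let m := dynamicsEstimate opts α st ot act M₀ t
    let s' := st (t + 1)
    let β := (opts o).termination s'
    if s = st t then
      m x s o + α t s o * importanceRatio opts (act t) s o (ot t) *
        (β * (if s' = x then 1 else 0) + (1 - β) * m x s' o - m x s o)
    else m x s o

open Classical in
/-- The estimates `M_t(s, o)` of the expected total of a per-step signal `c` (`c (t + 1)` is received
in the step from time `t` to time `t + 1`) accumulated until termination. -/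
def cumulantEstimate (opts : O → MDPOption S A) (α : ℕ → S → O → ℝ)
    (st : ℕ → S) (ot : ℕ → O) (act : ℕ → A) (c : ℕ → ℝ) (M₀ : S → O → ℝ) : ℕ → S → O → ℝ
  | 0 => M₀
  | t + 1 => fun s o =>
    let m := cumulantEstimate opts α st ot act c M₀ t
    let s' := st (t + 1)
    let β := (opts o).termination s'
    if s = st t then
      m s o + α t s o * importanceRatio opts (act t) s o (ot t) *
        (c (t + 1) + (1 - β) * m s' o - m s o)
    else m s o

/-- The estimates `M^r_t(s, o)`: the signal is the reward. -/
def rewardEstimate (opts : O → MDPOption S A) (α : ℕ → S → O → ℝ)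
    (st : ℕ → S) (ot : ℕ → O) (act : ℕ → A) (rew : ℕ → ℝ) (M₀ : S → O → ℝ) : ℕ → S → O → ℝ :=
  cumulantEstimate opts α st ot act rew M₀

/-- The estimates `M^l_t(s, o)`: the signal is one at every step. -/
def durationEstimate (opts : O → MDPOption S A) (α : ℕ → S → O → ℝ)
    (st : ℕ → S) (ot : ℕ → O) (act : ℕ → A) (M₀ : S → O → ℝ) : ℕ → S → O → ℝ :=
  cumulantEstimate opts α st ot act (fun _ => 1) M₀

end Algorithm

end

-- All three estimates are instances of one algorithm: temporal-difference learning of the expected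
-- total, up to termination, of a signal `G S_{t+1} R_{t+1}`. The three models solve the matching
-- Bellman equations m = E[G + (1 - β) m], by decomposing an execution at its first step
-- (`hasSum_optionTransitionProb_mul`). There is no discounting; contraction comes from the expected
-- duration w, whose Bellman equation reads E[(1 - β) w] = w - 1. Hence the continuation operator
-- contracts the sup norm weighted by w (`abs_stepExpectation_continue_le`).
--
-- The weighted error f = (estimate - m) / w then follows an asynchronous stochastic approximation:
-- it is averaged, with weight α, towards a target of size at most γ‖f‖, plus noise. Coverage lets
-- the importance ratio turn the mean update into that of the updated option. The noise scales with
-- iterates not known to be bounded, so it is divided by the running maximum B of 1 and ‖f‖. The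
-- normalised noise is a finite sum of martingale transforms with coefficients O(α), whose series
-- converge almost surely (`ae_exists_tendsto_of_summable_sq`).
--
-- The rest is pathwise (`tendsto_zero_of_contracting_targets`). Tails of the normalised noise are
-- small, so B stays bounded. The true noise series therefore converges as well, and removing its
-- vanishing tail gives limsup ‖f‖ ≤ γ limsup ‖f‖, hence f → 0.

/-! ### Real sequences: summation by parts and iterated averaging -/

/-- Abel summation: the boundary term is at most δ B n, and the increments of B against earlier
partial sums cost at most δ (B n - B 0). No upper bound on B is needed, so this applies before the
iterates are known to be bounded. -/
theorem abs_sum_range_succ_mul_le {B a : ℕ → ℝ} {δ : ℝ} (hB : Monotone B) (hB0 : 0 ≤ B 0)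
    (ha : ∀ n, |∑ k ∈ Finset.range n, a k| ≤ δ) (n : ℕ) :
    |∑ k ∈ Finset.range (n + 1), B k * a k| ≤ 2 * δ * B n := by
  have key : ∀ n, |∑ k ∈ Finset.range (n + 1), B k * a k
      - B n * ∑ k ∈ Finset.range (n + 1), a k| ≤ δ * (B n - B 0) := by
    intro n
    induction n with
    | zero => simp
    | succ n ih =>
      have h1 : ∑ k ∈ Finset.range (n + 1 + 1), B k * a k
          - B (n + 1) * ∑ k ∈ Finset.range (n + 1 + 1), a k
          = (∑ k ∈ Finset.range (n + 1), B k * a k - B n * ∑ k ∈ Finset.range (n + 1), a k)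
            - (B (n + 1) - B n) * ∑ k ∈ Finset.range (n + 1), a k := by
        rw [Finset.sum_range_succ _ (n + 1), Finset.sum_range_succ _ (n + 1)]; ring
      have h2 : 0 ≤ B (n + 1) - B n := sub_nonneg.2 (hB n.le_succ)
      have h3 : |(B (n + 1) - B n) * ∑ k ∈ Finset.range (n + 1), a k|
          ≤ (B (n + 1) - B n) * δ := by
        rw [abs_mul, abs_of_nonneg h2]
        exact mul_le_mul_of_nonneg_left (ha _) h2
      rw [h1]
      refine (abs_sub _ _).trans ?_
      linarith
  have hBn : 0 ≤ B n := hB0.trans (hB n.zero_le)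
  have hδ : 0 ≤ δ := (abs_nonneg _).trans (ha 0)
  have h1 : |B n * ∑ k ∈ Finset.range (n + 1), a k| ≤ B n * δ := by
    rw [abs_mul, abs_of_nonneg hBn]
    exact mul_le_mul_of_nonneg_left (ha _) hBn
  have h2 := key n
  have h3 := abs_add_le (∑ k ∈ Finset.range (n + 1), B k * a k
      - B n * ∑ k ∈ Finset.range (n + 1), a k) (B n * ∑ k ∈ Finset.range (n + 1), a k)
  rw [sub_add_cancel] at h3
  have h4 := mul_nonneg hδ hB0
  linarith

/-- Multiplying a convergent series by a bounded monotone sequence keeps it convergent. -/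
theorem exists_tendsto_sum_range_mul {B a : ℕ → ℝ} {C l : ℝ} (hB : Monotone B)
    (hBC : ∀ n, B n ≤ C)
    (ha : Tendsto (fun n => ∑ k ∈ Finset.range n, a k) atTop (𝓝 l)) :
    ∃ l', Tendsto (fun n => ∑ k ∈ Finset.range n, B k * a k) atTop (𝓝 l') := by
  obtain ⟨b, hb⟩ : ∃ b, Tendsto B atTop (𝓝 b) :=
    ⟨_, tendsto_atTop_ciSup hB ⟨C, by rintro _ ⟨n, rfl⟩; exact hBC n⟩⟩
  -- Dirichlet's test handles the weights B - b, which tend monotonically to zero; the remainder is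
  -- b times the given series.
  obtain ⟨K, hK⟩ := (Metric.isBounded_range_of_tendsto _ ha).exists_norm_le
  have h1 : CauchySeq fun n => ∑ i ∈ Finset.range n, (B i - b) • a i :=
    Monotone.cauchySeq_series_mul_of_tendsto_zero_of_bounded (b := K)
      (fun i j hij => sub_le_sub_right (hB hij) b)
      (by simpa using hb.sub_const b) (fun n => hK _ ⟨n, rfl⟩)
  obtain ⟨l', hl'⟩ := cauchySeq_tendsto_of_complete h1
  refine ⟨l' + b * l, (hl'.add (ha.const_mul b)).congr fun n => ?_⟩
  rw [Finset.mul_sum, ← Finset.sum_add_distrib]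
  exact Finset.sum_congr rfl fun i _ => by simp only [smul_eq_mul]; ring

theorem abs_convex_comb_le {a x y c : ℝ} (ha : a ∈ Set.Icc (0 : ℝ) 1) (hx : |x| ≤ c)
    (hy : |y| ≤ c) : |(1 - a) * x + a * y| ≤ c := by
  have h1 : 0 ≤ 1 - a := sub_nonneg.2 ha.2
  refine (abs_add_le _ _).trans ?_
  rw [abs_mul, abs_mul, abs_of_nonneg h1, abs_of_nonneg ha.1]
  nlinarith [mul_le_mul_of_nonneg_left hx h1, mul_le_mul_of_nonneg_left hy ha.1]

theorem tendsto_prod_one_sub_zero {α : ℕ → ℝ} (hα : ∀ t, α t ∈ Set.Icc (0 : ℝ) 1)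
    (hsum : Tendsto (fun n => ∑ t ∈ Finset.range n, α t) atTop atTop) :
    Tendsto (fun n => ∏ t ∈ Finset.range n, (1 - α t)) atTop (𝓝 0) := by
  refine squeeze_zero (fun n => Finset.prod_nonneg fun t _ => sub_nonneg.2 (hα t).2)
    (fun n => ?_) (Real.tendsto_exp_neg_atTop_nhds_zero.comp hsum)
  calc ∏ t ∈ Finset.range n, (1 - α t) ≤ ∏ t ∈ Finset.range n, Real.exp (-α t) :=
        Finset.prod_le_prod (fun t _ => sub_nonneg.2 (hα t).2)
          fun t _ => Real.one_sub_le_exp_neg _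
    _ = _ := by rw [← Real.exp_sum, Finset.sum_neg_distrib]; rfl

/-- Iterated averaging towards targets that are eventually bounded by `c`. -/
theorem eventually_abs_le_of_averaging {u α g : ℕ → ℝ} {c ε : ℝ}
    (hα : ∀ t, α t ∈ Set.Icc (0 : ℝ) 1)
    (hsum : Tendsto (fun n => ∑ t ∈ Finset.range n, α t) atTop atTop)
    (hu : ∀ t, u (t + 1) = (1 - α t) * u t + α t * g t)
    (hg : ∀ᶠ t in atTop, |g t| ≤ c) (hε : 0 < ε) :
    ∀ᶠ t in atTop, |u t| ≤ c + ε := by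
  obtain ⟨T, hT⟩ := eventually_atTop.1 hg
  have hα' : ∀ t, α (t + T) ∈ Set.Icc (0 : ℝ) 1 := fun t => hα _
  have hsum' : Tendsto (fun n => ∑ t ∈ Finset.range n, α (t + T)) atTop atTop := by
    have h1 := (tendsto_add_atTop_iff_nat T).2 hsum
    have h2 := tendsto_atTop_add_const_right atTop (-∑ t ∈ Finset.range T, α t) h1
    refine h2.congr fun n => ?_
    rw [add_comm n T, Finset.sum_range_add]
    simp [add_comm]
  -- After time T the value u T is damped by the product of the 1 - α, which tends to zero because
  -- the step sizes have infinite sum.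
  have hb : ∀ n, |u (n + T)| ≤ c + (∏ t ∈ Finset.range n, (1 - α (t + T))) * |u T| := by
    have hc : 0 ≤ c := (abs_nonneg _).trans (hT T le_rfl)
    intro n
    induction n with
    | zero => simpa using hc
    | succ n ih =>
      have h1 : 0 ≤ 1 - α (n + T) := sub_nonneg.2 (hα' n).2
      have h2 := hT (n + T) (Nat.le_add_left _ _)
      rw [show n + 1 + T = n + T + 1 by ring, hu, Finset.prod_range_succ]
      refine (abs_add_le _ _).trans ?_
      rw [abs_mul, abs_mul, abs_of_nonneg h1, abs_of_nonneg (hα' n).1]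
      have h3 := mul_le_mul_of_nonneg_left ih h1
      have h4 := mul_le_mul_of_nonneg_left h2 (hα' n).1
      linarith
  have h0 : Tendsto (fun n => (∏ t ∈ Finset.range n, (1 - α (t + T))) * |u T|) atTop (𝓝 0) := by
    simpa using (tendsto_prod_one_sub_zero hα' hsum').mul_const |u T|
  have h1 : ∀ᶠ n in atTop, |u (n + T)| ≤ c + ε := by
    filter_upwards [h0.eventually_lt_const hε] with n hn
    linarith [hb n]
  obtain ⟨N, hN⟩ := eventually_atTop.1 h1
  filter_upwards [eventually_ge_atTop (N + T)] with t ht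
  have := hN (t - T) (by omega)
  rwa [Nat.sub_add_cancel (by omega)] at this

/-! ### Pathwise convergence of the noisy contracting iteration -/

section Iteration

variable {S : Type*} [Fintype S]

/-- Subtracting the accumulated noise W leaves a noise-free averaging of f - W towards h - W. There
W costs 2δB, and adding it back costs another 2δB; γ + 4δ ≤ 1 absorbs both, so B can be pushed up
only through its initial value. -/
theorem bound_of_small_noise {f h d α : ℕ → S → ℝ} {B : ℕ → ℝ} {γ δ : ℝ}
    (hα : ∀ t s, α t s ∈ Set.Icc (0 : ℝ) 1)
    (hf : ∀ t s, f (t + 1) s = (1 - α t s) * f t s + α t s * h t s + B t * d t s)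
    (hγ : 0 ≤ γ) (hh : ∀ t s, |h t s| ≤ γ * ‖f t‖) (hB1 : ∀ t, 0 ≤ B t) (hB : Monotone B)
    (hfB : ∀ t, ‖f t‖ ≤ B t) (hBf : ∀ t, B (t + 1) ≤ max (B t) ‖f (t + 1)‖)
    (hδ0 : 0 ≤ δ) (hδ : γ + 4 * δ ≤ 1)
    (hd : ∀ n s, |∑ k ∈ Finset.range n, d k s| ≤ δ) (t : ℕ) :
    B t ≤ B 0 / (1 - 2 * δ) := by
  have hpos : 0 < 1 - 2 * δ := by linarith
  set W : ℕ → S → ℝ := fun n s => ∑ k ∈ Finset.range n, B k * d k s with hW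
  have hWb : ∀ n s, |W (n + 1) s| ≤ 2 * δ * B n := fun n s =>
    abs_sum_range_succ_mul_le hB (hB1 0) (fun n => hd n s) n
  have hu : ∀ n s, |f (n + 1) s - W (n + 1) s| ≤ max (B 0) ((γ + 2 * δ) * B n) := by
    intro n s
    have hstep : ∀ n, f (n + 1) s - W (n + 1) s
        = (1 - α n s) * (f n s - W n s) + α n s * (h n s - W n s) := by
      intro n
      simp only [hW, Finset.sum_range_succ, hf]; ring
    have hhn : ∀ n, |h n s| ≤ γ * B n := fun n =>
      (hh n s).trans (mul_le_mul_of_nonneg_left (hfB n) hγ)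
    induction n with
    | zero =>
      rw [hstep]
      refine abs_convex_comb_le (hα 0 s) (le_max_of_le_left ?_) (le_max_of_le_right ?_)
      · simp only [hW, Finset.range_zero, Finset.sum_empty, sub_zero]
        exact (norm_le_pi_norm (f 0) s).trans (hfB 0)
      · simp only [hW, Finset.range_zero, Finset.sum_empty, sub_zero]
        refine (hhn 0).trans (mul_le_mul_of_nonneg_right (by linarith) (hB1 0))
    | succ n ih =>
      rw [hstep]
      have hm : B n ≤ B (n + 1) := hB n.le_succ
      refine abs_convex_comb_le (hα _ s) (ih.trans (max_le_max le_rfl ?_)) (le_max_of_le_right ?_)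
      · exact mul_le_mul_of_nonneg_left hm (by linarith)
      · refine (abs_sub _ _).trans ?_
        have h1 := hhn (n + 1)
        have h2 := hWb n s
        have h3 := mul_le_mul_of_nonneg_left hm hδ0
        linarith
  induction t with
  | zero =>
    rw [le_div_iff₀ hpos]
    nlinarith [hB1 0]
  | succ t ih =>
    refine (hBf t).trans (max_le ih ?_)
    -- The bound is the fixed point of D = B 0 + 2δD, the case in which f - W is still governed by B
    -- 0.
    have hD : B 0 / (1 - 2 * δ) = B 0 + 2 * δ * (B 0 / (1 - 2 * δ)) := by
      field_simp; ring
    have hD0 : 0 ≤ B 0 / (1 - 2 * δ) := div_nonneg (hB1 0) hpos.le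
    refine (pi_norm_le_iff_of_nonneg hD0).2 fun s => ?_
    have h1 := hu t s
    have h2 := hWb t s
    have h3 : |f (t + 1) s| ≤ |f (t + 1) s - W (t + 1) s| + |W (t + 1) s| := by
      simpa using abs_add_le (f (t + 1) s - W (t + 1) s) (W (t + 1) s)
    rw [Real.norm_eq_abs]
    have h4 := mul_le_mul_of_nonneg_left ih hδ0
    rcases le_max_iff.1 h1 with h1 | h1
    · linarith
    · have h5 := mul_le_mul_of_nonneg_right hδ (hB1 t)
      linarith

/-- Asynchronous stochastic approximation, pathwise: a noisy iteration towards targets that contract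
the sup norm converges to zero if the noise, relative to the running bound `B` of the iterates, forms
convergent series. -/
theorem tendsto_zero_of_contracting_targets {f h d α : ℕ → S → ℝ} {B : ℕ → ℝ} {γ : ℝ}
    (hα : ∀ t s, α t s ∈ Set.Icc (0 : ℝ) 1)
    (hsum : ∀ s, Tendsto (fun n => ∑ t ∈ Finset.range n, α t s) atTop atTop)
    (hf : ∀ t s, f (t + 1) s = (1 - α t s) * f t s + α t s * h t s + B t * d t s)
    (hγ : 0 ≤ γ) (hγ1 : γ < 1)
    (hh : ∀ t s, |h t s| ≤ γ * ‖f t‖) (hB : Monotone B)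
    (hfB : ∀ t, ‖f t‖ ≤ B t) (hBf : ∀ t, B (t + 1) ≤ max (B t) ‖f (t + 1)‖)
    (hd : ∀ s, ∃ l, Tendsto (fun n => ∑ k ∈ Finset.range n, d k s) atTop (𝓝 l)) :
    Tendsto f atTop (𝓝 0) := by
  have hB1 : ∀ t, 0 ≤ B t := fun t => (norm_nonneg _).trans (hfB t)
  choose l hl using hd
  have hbound : ∃ C, ∀ t, B t ≤ C := by
    -- This δ makes γ + 4δ = 1. The Cauchy property keeps all noise sums started at a late T below
    -- δ, and the iteration is restarted at T.
    set δ := (1 - γ) / 4 with hδ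
    have hδ0 : 0 < δ := by simp only [hδ]; linarith
    have hev : ∀ᶠ T in atTop, ∀ s, |∑ k ∈ Finset.range T, d k s - l s| < δ / 2 := by
      rw [eventually_all]
      intro s
      exact (Metric.tendsto_nhds.1 (hl s)) (δ / 2) (by positivity)
    obtain ⟨T, hT⟩ := eventually_atTop.1 hev
    refine ⟨B T / (1 - 2 * δ), fun t => (hB (Nat.le_add_left t T)).trans ?_⟩
    refine bound_of_small_noise (f := fun t => f (T + t)) (h := fun t => h (T + t))
      (d := fun t => d (T + t)) (α := fun t => α (T + t)) (B := fun t => B (T + t)) (γ := γ)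
      (fun t s => hα _ s) (fun t s => hf _ s) hγ (fun t s => hh _ s) (fun t => hB1 _)
      (fun i j hij => hB (by omega)) (fun t => hfB _) (fun t => hBf _)
      hδ0.le (by simp only [hδ]; linarith) (fun n s => ?_) t
    have h1 := hT (T + n) (Nat.le_add_right _ _) s
    have h2 := hT T le_rfl s
    rw [Finset.sum_range_add] at h1
    rw [abs_lt] at h1 h2
    rw [abs_le]
    constructor <;> linarith
  obtain ⟨C, hC⟩ := hbound
  have hW : ∀ s, ∃ l', Tendsto (fun n => ∑ k ∈ Finset.range n, B k * d k s) atTop (𝓝 l') :=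
    fun s => exists_tendsto_sum_range_mul hB hC (hl s)
  choose W hW using hW
  have hz : ∀ s, Tendsto (fun n => ∑ k ∈ Finset.range n, B k * d k s - W s) atTop (𝓝 0) :=
    fun s => by simpa using (hW s).sub_const (W s)
  -- With the noise tail (partial sum minus limit W) subtracted, f is averaged towards h minus that
  -- tail, eventually of size at most γ D + ε / 3. Averaging and adding the tail back cost ε / 3
  -- each.
  have hshrink : ∀ D, (∀ᶠ t in atTop, ‖f t‖ ≤ D) → ∀ ε > 0, ∀ᶠ t in atTop, ‖f t‖ ≤ γ * D + ε := by
    intro D hD ε hε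
    have hD0 : 0 ≤ D := by
      obtain ⟨t, ht⟩ := hD.exists
      exact (norm_nonneg _).trans ht
    have h1 : ∀ s, ∀ᶠ t in atTop, |f t s| ≤ γ * D + ε := by
      intro s
      have hzε : ∀ᶠ n in atTop, |∑ k ∈ Finset.range n, B k * d k s - W s| < ε / 3 := by
        simpa [Real.dist_eq] using (Metric.tendsto_nhds.1 (hz s)) (ε / 3) (by positivity)
      have h2 := eventually_abs_le_of_averaging
        (u := fun t => f t s - (∑ k ∈ Finset.range t, B k * d k s - W s))
        (g := fun t => h t s - (∑ k ∈ Finset.range t, B k * d k s - W s))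
        (c := γ * D + ε / 3) (ε := ε / 3) (fun t => hα t s) (hsum s)
        (fun t => by simp only [Finset.sum_range_succ, hf]; ring)
        (by
          filter_upwards [hD, hzε] with t ht hzt
          have h3 := (hh t s).trans (mul_le_mul_of_nonneg_left ht hγ)
          exact (abs_sub _ _).trans (by linarith)) (by positivity)
      filter_upwards [h2, hzε] with t ht hzt
      have h3 := abs_add_le (f t s - (∑ k ∈ Finset.range t, B k * d k s - W s))
        (∑ k ∈ Finset.range t, B k * d k s - W s)
      rw [sub_add_cancel] at h3
      linarith
    filter_upwards [eventually_all.2 h1] with t ht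
    exact (pi_norm_le_iff_of_nonneg (by positivity)).2 ht
  have hpow : ∀ n : ℕ, ∀ ε > 0, ∀ᶠ t in atTop, ‖f t‖ ≤ γ ^ n * C + ε := by
    intro n
    induction n with
    | zero =>
      intro ε hε
      filter_upwards with t
      simpa using ((hfB t).trans (hC t)).trans (by linarith)
    | succ n ih =>
      intro ε hε
      filter_upwards [hshrink _ (ih (ε / 2) (by positivity)) (ε / 2) (by positivity)] with t ht
      rw [pow_succ]
      nlinarith
  rw [Metric.tendsto_nhds]
  intro ε hε
  have h1 : Tendsto (fun n => γ ^ n * C) atTop (𝓝 0) := by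
    simpa using (tendsto_pow_atTop_nhds_zero_of_lt_one hγ hγ1).mul_const C
  obtain ⟨n, hn⟩ := (h1.eventually_lt_const (half_pos hε)).exists
  filter_upwards [hpow n (ε / 3) (by positivity)] with t ht
  rw [dist_zero_right]
  linarith

end Iteration

/-! ### Almost sure convergence of martingale transforms -/

section MartingaleTransform

variable {Ω : Type*} {m0 : MeasurableSpace Ω} {P : Measure Ω} [IsProbabilityMeasure P]
  {ℱ : Filtration ℕ m0}

theorem integrable_of_measurable_of_abs_le {f : Ω → ℝ} (hf : Measurable f) {C : ℝ}
    (h : ∀ ω, |f ω| ≤ C) : Integrable f P :=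
  .of_bound hf.aestronglyMeasurable C (.of_forall h)

/-- A martingale transform with bounded increments and summable squared coefficients converges
almost surely. -/
theorem ae_exists_tendsto_of_sum_sq_le {k ξ : ℕ → Ω → ℝ} {C N : ℝ}
    (hk : ∀ t, Measurable[ℱ t] (k t)) (hξ : ∀ t, Measurable[ℱ (t + 1)] (ξ t))
    (hξC : ∀ t ω, |ξ t ω| ≤ C) (hξ0 : ∀ t, P[ξ t | ℱ t] =ᵐ[P] 0)
    (hN : ∀ n ω, ∑ t ∈ Finset.range n, k t ω ^ 2 ≤ N) :
    ∀ᵐ ω ∂P, ∃ l, Tendsto (fun n => ∑ t ∈ Finset.range n, k t ω * ξ t ω) atTop (𝓝 l) := by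
  set X : ℕ → Ω → ℝ := fun n ω => ∑ t ∈ Finset.range n, k t ω * ξ t ω with hX
  obtain ⟨ω₀⟩ : Nonempty Ω := P.nonempty_of_neZero
  have hC : 0 ≤ C := (abs_nonneg _).trans (hξC 0 ω₀)
  have hN0 : 0 ≤ N := by simpa using hN 0 ω₀
  have hkN : ∀ t ω, |k t ω| ≤ √N := fun t ω => by
    refine Real.abs_le_sqrt (le_trans ?_ (hN (t + 1) ω))
    exact Finset.single_le_sum (f := fun t => k t ω ^ 2) (fun _ _ => sq_nonneg _)
      (Finset.self_mem_range_succ t)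
  have hXC : ∀ n ω, |X n ω| ≤ n * (√N * C) := fun n ω => by
    refine (Finset.abs_sum_le_sum_abs _ _).trans ?_
    refine (Finset.sum_le_card_nsmul _ _ (√N * C) fun t _ => ?_).trans (by simp)
    rw [abs_mul]
    exact mul_le_mul (hkN t ω) (hξC t ω) (abs_nonneg _) (Real.sqrt_nonneg _)
  have hXm : ∀ n, Measurable[ℱ n] (X n) := fun n => by
    refine Finset.measurable_fun_sum _ fun t ht => ?_
    have h1 : t + 1 ≤ n := Finset.mem_range.1 ht
    exact ((hk t).mono (ℱ.mono (by omega)) le_rfl).mul ((hξ t).mono (ℱ.mono h1) le_rfl)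
  have hξi : ∀ t, Integrable (ξ t) P := fun t =>
    integrable_of_measurable_of_abs_le ((hξ t).mono (ℱ.le _) le_rfl) (hξC t)
  have hXi : ∀ n, Integrable (X n) P := fun n =>
    integrable_of_measurable_of_abs_le ((hXm n).mono (ℱ.le _) le_rfl) (hXC n)
  have hzero : ∀ (n : ℕ) (g : Ω → ℝ) (K : ℝ), Measurable[ℱ n] g → (∀ ω, |g ω| ≤ K) →
      P[g * ξ n | ℱ n] =ᵐ[P] 0 := fun n g K hg hgK => by
    filter_upwards [condExp_stronglyMeasurable_mul_of_bound (ℱ.le n) hg.stronglyMeasurable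
      (hξi n) K (.of_forall hgK), hξ0 n] with ω h1 h2
    rw [h1, Pi.mul_apply, h2]; simp
  have hmart : Martingale X ℱ P := by
    refine martingale_of_condExp_sub_eq_zero_nat (fun n => (hXm n).stronglyMeasurable) hXi
      fun n => ?_
    have h1 : X (n + 1) - X n = k n * ξ n := by
      ext ω; simp [hX, Finset.sum_range_succ]
    rw [h1]
    exact hzero n _ _ (hk n) (hkN n)
  have hkm : ∀ t, Measurable (k t) := fun t => (hk t).mono (ℱ.le _) le_rfl
  have hξm : ∀ t, Measurable (ξ t) := fun t => (hξ t).mono (ℱ.le _) le_rfl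
  have hXm' : ∀ t, Measurable (X t) := fun t => (hXm t).mono (ℱ.le _) le_rfl
  have hsqi : ∀ t, Integrable (fun ω => k t ω ^ 2) P := fun t =>
    integrable_of_measurable_of_abs_le (C := N) ((hkm t).pow_const 2) fun ω => by
      rw [abs_of_nonneg (sq_nonneg _)]
      exact (Finset.single_le_sum (f := fun t => k t ω ^ 2) (fun _ _ => sq_nonneg _)
        (Finset.self_mem_range_succ t)).trans (hN (t + 1) ω)
  have hXsqi : ∀ n, Integrable (fun ω => X n ω ^ 2) P := fun n =>
    integrable_of_measurable_of_abs_le ((hXm' n).pow_const 2) (C := (n * (√N * C)) ^ 2)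
      fun ω => by
        rw [abs_of_nonneg (sq_nonneg _), ← sq_abs]
        exact pow_le_pow_left₀ (abs_nonneg _) (hXC n ω) 2
  -- Martingale increments are orthogonal: expanding the square, the cross term integrates to zero
  -- because X n * k n is bounded and known at time n.
  have hL2 : ∀ n, ∫ ω, X n ω ^ 2 ∂P ≤ C ^ 2 * ∑ t ∈ Finset.range n, ∫ ω, k t ω ^ 2 ∂P := by
    intro n
    induction n with
    | zero => simp [hX]
    | succ n ih =>
      have hgm : Measurable[ℱ n] (X n * k n) := (hXm n).mul (hk n)
      have hgb : ∀ ω, |(X n * k n) ω| ≤ n * (√N * C) * √N := fun ω => by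
        rw [Pi.mul_apply, abs_mul]
        exact mul_le_mul (hXC n ω) (hkN n ω) (abs_nonneg _) (by positivity)
      have hcross : ∫ ω, (X n * k n * ξ n) ω ∂P = 0 := by
        rw [← integral_condExp (ℱ.le n), integral_congr_ae (hzero n _ _ hgm hgb)]
        simp
      have hci : Integrable (X n * k n * ξ n) P :=
        (hξi n).bdd_mul (c := n * (√N * C) * √N) (hgm.mono (ℱ.le _) le_rfl).aestronglyMeasurable
          (.of_forall hgb)
      have hpt : ∀ ω, X (n + 1) ω ^ 2
          ≤ X n ω ^ 2 + 2 * (X n * k n * ξ n) ω + C ^ 2 * k n ω ^ 2 := fun ω => by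
        have h1 : X (n + 1) ω = X n ω + k n ω * ξ n ω := by simp [hX, Finset.sum_range_succ]
        have h2 : ξ n ω ^ 2 ≤ C ^ 2 := by
          rw [← sq_abs]; exact pow_le_pow_left₀ (abs_nonneg _) (hξC n ω) 2
        have h3 := mul_le_mul_of_nonneg_right h2 (sq_nonneg (k n ω))
        simp only [h1, Pi.mul_apply]
        nlinarith
      have h4 := integral_mono (hXsqi (n + 1))
        (((hXsqi n).add (hci.const_mul 2)).add ((hsqi n).const_mul (C ^ 2))) hpt
      rw [integral_add' ((hXsqi n).add (hci.const_mul 2)) ((hsqi n).const_mul (C ^ 2)),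
        integral_add' (hXsqi n) (hci.const_mul 2), integral_const_mul, integral_const_mul,
        hcross] at h4
      rw [Finset.sum_range_succ, mul_add]
      linarith
  have hL2' : ∀ n, ∫ ω, X n ω ^ 2 ∂P ≤ C ^ 2 * N := fun n => by
    refine (hL2 n).trans (mul_le_mul_of_nonneg_left ?_ (sq_nonneg C))
    rw [← integral_finsetSum _ fun t _ => hsqi t]
    have h1 := integral_mono (integrable_finsetSum (Finset.range n) fun t _ => hsqi t)
      (integrable_const N) (fun ω => hN n ω)
    simpa using h1
  refine hmart.submartingale.exists_ae_tendsto_of_bdd (R := (1 + C ^ 2 * N).toNNReal) fun n => ?_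
  rw [eLpNorm_one_eq_lintegral_enorm, ← ofReal_integral_norm_eq_lintegral_enorm (hXi n)]
  refine ENNReal.ofReal_le_ofReal ?_
  -- The L² bound gives the L¹ bound of Doob's theorem through |x| ≤ 1 + x².
  have h1 := integral_mono (hXi n).norm ((integrable_const (1 : ℝ)).add (hXsqi n)) fun ω => by
    change |X n ω| ≤ 1 + X n ω ^ 2
    rw [← sq_abs]
    nlinarith [sq_nonneg (|X n ω| - 1)]
  rw [integral_add' (integrable_const (1 : ℝ)) (hXsqi n)] at h1
  simp only [integral_const, probReal_univ, one_smul] at h1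
  linarith [hL2' n]

/-- A martingale transform whose squared coefficients are almost surely summable converges almost
surely. -/
theorem ae_exists_tendsto_of_summable_sq {k ξ : ℕ → Ω → ℝ} {C : ℝ}
    (hk : ∀ t, Measurable[ℱ t] (k t)) (hξ : ∀ t, Measurable[ℱ (t + 1)] (ξ t))
    (hξC : ∀ t ω, |ξ t ω| ≤ C) (hξ0 : ∀ t, P[ξ t | ℱ t] =ᵐ[P] 0)
    (hsq : ∀ᵐ ω ∂P, Summable fun t => k t ω ^ 2) :
    ∀ᵐ ω ∂P, ∃ l, Tendsto (fun n => ∑ t ∈ Finset.range n, k t ω * ξ t ω) atTop (𝓝 l) := by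
  set q : ℕ → Ω → ℝ := fun n ω => ∑ t ∈ Finset.range n, k t ω ^ 2 with hq
  have hqm : ∀ t, Measurable[ℱ t] (q (t + 1)) := fun t =>
    Finset.measurable_fun_sum _ fun i hi =>
      ((hk i).mono (ℱ.mono (Nat.lt_succ_iff.1 (Finset.mem_range.1 hi))) le_rfl).pow_const 2
  -- Localisation: coefficients are set to zero once the sum of squares exceeds N. The test includes
  -- the current k t, which is known at time t, so the truncation stays predictable and never
  -- overshoots N.
  have htrunc : ∀ N : ℕ, ∀ᵐ ω ∂P, ∃ l, Tendsto (fun n => ∑ t ∈ Finset.range n,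
      ({ω | q (t + 1) ω ≤ N}.indicator (k t) ω) * ξ t ω) atTop (𝓝 l) := fun N => by
    refine ae_exists_tendsto_of_sum_sq_le (ℱ := ℱ) (C := C) (N := N)
      (fun t => (hk t).indicator ((hqm t) measurableSet_Iic)) hξ hξC hξ0 fun n ω => ?_
    induction n with
    | zero => simp
    | succ n ih =>
      by_cases h : q (n + 1) ω ≤ N
      · refine le_trans (Finset.sum_le_sum fun t _ => ?_) h
        rw [Set.indicator_apply]
        split_ifs
        · exact le_rfl
        · simpa using sq_nonneg (k t ω)
      · rw [Finset.sum_range_succ, Set.indicator_of_notMem (s := {ω | q (n + 1) ω ≤ N}) h]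
        simpa using ih
  filter_upwards [ae_all_iff.2 htrunc, hsq] with ω h1 h2
  obtain ⟨N, hN⟩ := exists_nat_ge (∑' t, k t ω ^ 2)
  obtain ⟨l, hl⟩ := h1 N
  refine ⟨l, hl.congr fun n => Finset.sum_congr rfl fun t _ => ?_⟩
  rw [Set.indicator_of_mem]
  exact (h2.sum_le_tsum _ fun i _ => sq_nonneg _).trans hN

end MartingaleTransform

/-! ### First-step analysis of options and the Bellman equations -/

section OptionRecursion

variable {S A : Type*} [Fintype S] [Fintype A]

/-- The expectation of `F s' r` over the next state `s'` and reward `r` when the option `o` is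
followed for one step from `s`. -/
def stepExpectation (M : FiniteMDP S A) (o : MDPOption S A) (s : S) (F : S → ℝ → ℝ) : ℝ :=
  ∑ a, ∑ s', ∑ r : M.rewards, o.policy a s * M.p s' r s a * F s' r

theorem stepExpectation_const (M : FiniteMDP S A) (o : MDPOption S A) (s : S) (c : ℝ) :
    stepExpectation M o s (fun _ _ => c) = c := by
  simp only [stepExpectation, ← Finset.sum_mul, ← Finset.mul_sum, M.p_sum, mul_one, o.policy_sum,
    one_mul]

theorem stepExpectation_add (M : FiniteMDP S A) (o : MDPOption S A) (s : S) (F G : S → ℝ → ℝ) :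
    stepExpectation M o s (fun s' r => F s' r + G s' r)
      = stepExpectation M o s F + stepExpectation M o s G := by
  simp only [stepExpectation, mul_add, Finset.sum_add_distrib]

theorem stepExpectation_sub (M : FiniteMDP S A) (o : MDPOption S A) (s : S) (F G : S → ℝ → ℝ) :
    stepExpectation M o s (fun s' r => F s' r - G s' r)
      = stepExpectation M o s F - stepExpectation M o s G := by
  simp only [stepExpectation, mul_sub, Finset.sum_sub_distrib]

theorem stepExpectation_mono (M : FiniteMDP S A) (o : MDPOption S A) (s : S) {F G : S → ℝ → ℝ}
    (h : ∀ s' r, F s' r ≤ G s' r) : stepExpectation M o s F ≤ stepExpectation M o s G :=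
  Finset.sum_le_sum fun _ _ => Finset.sum_le_sum fun _ _ => Finset.sum_le_sum fun _ _ =>
    mul_le_mul_of_nonneg_left (h _ _) (mul_nonneg (o.policy_nonneg _ _) (M.p_nonneg _ _ _ _))

theorem stepExpectation_const_mul (M : FiniteMDP S A) (o : MDPOption S A) (s : S) (c : ℝ)
    (F : S → ℝ → ℝ) :
    stepExpectation M o s (fun s' r => c * F s' r) = c * stepExpectation M o s F := by
  simp only [stepExpectation, Finset.mul_sum]
  exact Finset.sum_congr rfl fun _ _ => Finset.sum_congr rfl fun _ _ =>
    Finset.sum_congr rfl fun _ _ => by ring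

theorem abs_stepExpectation_le (M : FiniteMDP S A) (o : MDPOption S A) (s : S)
    (F : S → ℝ → ℝ) :
    |stepExpectation M o s F| ≤ stepExpectation M o s fun s' r => |F s' r| := by
  rw [abs_le]
  constructor
  · have := stepExpectation_const_mul M o s (-1) fun s' r => |F s' r|
    rw [neg_one_mul] at this
    rw [← this]
    exact stepExpectation_mono M o s fun s' r => by
      rw [neg_one_mul]; exact neg_abs_le _
  · exact stepExpectation_mono M o s fun s' r => le_abs_self _

theorem Fintype.sum_fin_cons {T : Type*} [Fintype T] {n : ℕ} (f : (Fin (n + 1) → T) → ℝ) :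
    ∑ x, f x = ∑ t, ∑ x' : Fin n → T, f (Fin.cons t x') := by
  rw [← Fintype.sum_prod_type' fun t (x' : Fin n → T) => f (Fin.cons t x')]
  exact (Fintype.sum_equiv (Fin.consEquiv fun _ => T) _ _ fun _ => rfl).symm

theorem executionProb_cons (M : FiniteMDP S A) (o : MDPOption S A) (n : ℕ) (s : S)
    (x : Fin (n + 2) → S) (b : A) (a : Fin (n + 1) → A) (v : M.rewards)
    (u : Fin (n + 1) → M.rewards) :
    executionProb M o (n + 1) (Fin.cons s x : Fin (n + 1 + 2) → S)
        (Fin.cons b a : Fin (n + 1 + 1) → A) (Fin.cons v u : Fin (n + 1 + 1) → M.rewards)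
      = o.policy b s * M.p (x 0) v s b * (1 - o.termination (x 0)) * executionProb M o n x a u := by
  have h1 : (Fin.cons s x : Fin (n + 1 + 2) → S) (Fin.last (n + 1 + 1)) = x (Fin.last (n + 1)) := by
    rw [← Fin.succ_last, Fin.cons_succ]
  have h2 : ∀ i : Fin (n + 1), (Fin.cons s x : Fin (n + 1 + 2) → S) i.succ.castSucc
      = x i.castSucc := fun i => by
    rw [← Fin.succ_castSucc, Fin.cons_succ]
  have h3 : ∏ i : Fin (n + 1 + 1), o.policy ((Fin.cons b a : Fin (n + 1 + 1) → A) i)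
        ((Fin.cons s x : Fin (n + 1 + 2) → S) i.castSucc) *
        M.p ((Fin.cons s x : Fin (n + 1 + 2) → S) i.succ)
          ((Fin.cons v u : Fin (n + 1 + 1) → M.rewards) i)
          ((Fin.cons s x : Fin (n + 1 + 2) → S) i.castSucc)
          ((Fin.cons b a : Fin (n + 1 + 1) → A) i)
      = o.policy b s * M.p (x 0) v s b * ∏ i : Fin (n + 1),
        o.policy (a i) (x i.castSucc) * M.p (x i.succ) (u i) (x i.castSucc) (a i) := by
    rw [Fin.prod_univ_succ]
    rfl
  have h4 : ∏ i : Fin (n + 1), (1 - o.termination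
        ((Fin.cons s x : Fin (n + 1 + 2) → S) i.succ.castSucc))
      = (1 - o.termination (x 0)) * ∏ i : Fin n, (1 - o.termination (x i.succ.castSucc)) := by
    rw [Fin.prod_univ_succ]
    rfl
  rw [executionProb, executionProb, h1, h3, h4]
  ring

theorem optionTransitionProb_one (M : FiniteMDP S A) (o : MDPOption S A) (s x : S) (r : ℝ) :
    open Classical in
    optionTransitionProb M o s x r 1 = stepExpectation M o s fun s' v =>
      if s' = x ∧ v = r then o.termination s' else 0 := by
  classical
  have hS : ∀ f : (Fin 2 → S) → ℝ, ∑ y, f y = ∑ y₀, ∑ y₁, f ![y₀, y₁] := fun f => by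
    rw [Fintype.sum_fin_cons]
    refine Finset.sum_congr rfl fun y₀ _ => ?_
    exact Fintype.sum_equiv (Equiv.funUnique (Fin 1) S) _ _ fun y => congrArg f (by
      ext i; fin_cases i <;> rfl)
  have hA : ∀ f : (Fin 1 → A) → ℝ, ∑ y, f y = ∑ y₀, f ![y₀] := fun f =>
    Fintype.sum_equiv (Equiv.funUnique (Fin 1) A) _ _ fun y => congrArg f (by
      ext i; fin_cases i; rfl)
  have hR : ∀ f : (Fin 1 → M.rewards) → ℝ, ∑ y, f y = ∑ y₀, f ![y₀] := fun f =>
    Fintype.sum_equiv (Equiv.funUnique (Fin 1) M.rewards) _ _ fun y => congrArg f (by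
      ext i; fin_cases i; rfl)
  rw [optionTransitionProb, hS, Finset.sum_eq_single s]
  · simp only [hA, hR, stepExpectation]
    rw [Finset.sum_comm]
    refine Finset.sum_congr rfl fun b _ => Finset.sum_congr rfl fun y _ =>
      Finset.sum_congr rfl fun v _ => ?_
    simp [executionProb]
  · intro y _ hy
    simp [hy]
  · simp

theorem optionTransitionProb_add_two (M : FiniteMDP S A) (o : MDPOption S A) (s x : S) (r : ℝ)
    (n : ℕ) :
    optionTransitionProb M o s x r (n + 2) = stepExpectation M o s fun s' v =>
      (1 - o.termination s') * optionTransitionProb M o s' x (r - v) (n + 1) := by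
  classical
  have hswap : ∀ F : (Fin (n + 2) → S) → A → (Fin (n + 1) → A) → M.rewards →
      (Fin (n + 1) → M.rewards) → ℝ, ∑ y, ∑ b, ∑ a, ∑ v, ∑ u, F y b a v u
        = ∑ b, ∑ v, ∑ y, ∑ a, ∑ u, F y b a v u := fun F => by
    rw [Finset.sum_comm]
    exact Finset.sum_congr rfl fun b _ =>
      (Finset.sum_congr rfl fun y _ => Finset.sum_comm).trans Finset.sum_comm
  rw [optionTransitionProb, Fintype.sum_fin_cons,
    Finset.sum_eq_single s (fun s' _ hs' => by simp [hs']) (by simp)]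
  simp only [Fintype.sum_fin_cons (T := A) (n := n + 1),
    Fintype.sum_fin_cons (T := M.rewards) (n := n + 1)]
  rw [hswap, stepExpectation]
  refine Finset.sum_congr rfl fun b _ => ?_
  rw [Finset.sum_comm (s := (Finset.univ : Finset S))]
  refine Finset.sum_congr rfl fun v _ => ?_
  simp only [optionTransitionProb, Finset.mul_sum]
  rw [Finset.sum_comm (s := (Finset.univ : Finset S))]
  refine Finset.sum_congr rfl fun y _ => ?_
  rw [Finset.sum_eq_single (y 0) (fun s' _ hs' => by simp [hs'.symm]) (by simp)]
  refine Finset.sum_congr rfl fun a _ => Finset.sum_congr rfl fun u _ => ?_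
  rw [executionProb_cons, ← Fin.succ_last, Fin.cons_succ, Fin.sum_univ_succ]
  simp only [Fin.cons_zero, Fin.cons_succ, true_and, ← eq_sub_iff_add_eq']
  split_ifs
  · ring
  · simp

open Classical in
/-- First-step decomposition of the option transition probabilities. -/
theorem optionTransitionProb_succ (M : FiniteMDP S A) (o : MDPOption S A) (s x : S) (r : ℝ)
    (l : ℕ) :
    optionTransitionProb M o s x r (l + 1) = stepExpectation M o s fun s' v =>
      (if (x, r, l) = (s', v, 0) then o.termination s' else 0) +
        (1 - o.termination s') * optionTransitionProb M o s' x (r - v) l := by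
  -- Only one of the two summands survives: executions of length 0 have probability 0, and the
  -- indicator requires l = 0.
  cases l with
  | zero =>
    have h0 : ∀ s' r', optionTransitionProb M o s' x r' 0 = 0 := fun _ _ => rfl
    simp [optionTransitionProb_one, h0, eq_comm]
  | succ n => simp [optionTransitionProb_add_two]

/-- Source of all three Bellman equations: g is a functional of final state, total reward and
length. After a first step with reward v, either the option stops with length 1, or a fresh
execution runs with v and 1 added to its totals. -/
theorem hasSum_optionTransitionProb_mul (M : FiniteMDP S A) (o : MDPOption S A) (s : S)
    (g : S × ℝ × ℕ → ℝ) (e : S → ℝ → ℝ)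
    (he : ∀ s' v, HasSum
      (fun z : S × ℝ × ℕ => optionTransitionProb M o s' z.1 z.2.1 z.2.2 *
        g (z.1, z.2.1 + v, z.2.2 + 1)) (e s' v)) :
    HasSum (fun z : S × ℝ × ℕ => optionTransitionProb M o s z.1 z.2.1 z.2.2 * g z)
      (stepExpectation M o s fun s' v =>
        o.termination s' * g (s', v, 1) + (1 - o.termination s') * e s' v) := by
  classical
  -- Length 0 carries no mass, so the sum may be reindexed by length minus one.
  have hinj : Function.Injective fun z : S × ℝ × ℕ => (z.1, z.2.1, z.2.2 + 1) := by
    rintro ⟨x, r, l⟩ ⟨x', r', l'⟩ h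
    simpa using h
  rw [← hinj.hasSum_iff]
  swap
  · rintro ⟨x, r, l⟩ h
    cases l with
    | zero => simp [optionTransitionProb]
    | succ l => exact absurd ⟨(x, r, l), rfl⟩ h
  have h1 : ∀ s' v, HasSum (fun z : S × ℝ × ℕ =>
      ((if z = (s', v, 0) then o.termination s' else 0) +
        (1 - o.termination s') * optionTransitionProb M o s' z.1 (z.2.1 - v) z.2.2) *
          g (z.1, z.2.1, z.2.2 + 1))
      (o.termination s' * g (s', v, 1) + (1 - o.termination s') * e s' v) := by
    intro s' v
    simp only [add_mul]
    refine HasSum.add ?_ ?_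
    · have := hasSum_single (f := fun z : S × ℝ × ℕ =>
        (if z = (s', v, 0) then o.termination s' else 0) * g (z.1, z.2.1, z.2.2 + 1)) (s', v, 0)
        (fun z hz => by simp [hz])
      simpa using this
    · have h2 := (he s' v).mul_left (1 - o.termination s')
      -- Translating the total reward by v turns the remaining reward r - v back into r.
      let φ : S × ℝ × ℕ ≃ S × ℝ × ℕ :=
        (Equiv.refl S).prodCongr ((Equiv.addRight v).prodCongr (Equiv.refl ℕ))
      rw [← φ.hasSum_iff]
      refine h2.congr_fun ?_
      intro z
      simp [φ, mul_assoc]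
  have h2 := hasSum_sum (s := Finset.univ) fun (b : A) _ => hasSum_sum (s := Finset.univ)
    fun (s' : S) _ => hasSum_sum (s := Finset.univ) fun (v : M.rewards) _ =>
      (h1 s' v).mul_left (o.policy b s * M.p s' v s b)
  refine h2.congr_fun ?_
  rintro ⟨x, r, l⟩
  simp only [Function.comp, optionTransitionProb_succ, stepExpectation, Finset.sum_mul, mul_assoc]

theorem dynamicsModel_eq_tsum (M : FiniteMDP S A) (o : MDPOption S A) (x s : S) :
    open Classical in
    dynamicsModel M o x s = ∑' z : S × ℝ × ℕ,
      optionTransitionProb M o s z.1 z.2.1 z.2.2 * (if z.1 = x then 1 else 0) := by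
  classical
  have hinj : Function.Injective fun y : ℝ × ℕ => (x, y) := fun y y' h => by simpa using h
  rw [dynamicsModel, ← hinj.tsum_eq]
  · simp
  · rintro ⟨x', y⟩ h
    by_cases hx : x' = x
    · exact ⟨y, by rw [hx]⟩
    · simp [hx] at h

open Classical in
theorem dynamicsModel_eq_stepExpectation (M : FiniteMDP S A) (o : MDPOption S A)
    (h : ∀ s, FiniteExpectedDuration M o s) (x s : S) :
    dynamicsModel M o x s = stepExpectation M o s fun s' _ =>
      o.termination s' * (if s' = x then 1 else 0) +
        (1 - o.termination s') * dynamicsModel M o x s' := by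
  rw [dynamicsModel_eq_tsum]
  refine (hasSum_optionTransitionProb_mul M o s (fun z => if z.1 = x then 1 else 0)
    (fun s' _ => dynamicsModel M o x s') fun s' v => ?_).tsum_eq
  rw [dynamicsModel_eq_tsum]
  refine Summable.hasSum (Summable.of_nonneg_of_le (fun z => ?_) (fun z => ?_) (h s').1.summable)
  · exact mul_nonneg (optionTransitionProb_nonneg _ _ _ _ _ _) (by split_ifs <;> norm_num)
  · exact mul_le_of_le_one_right (optionTransitionProb_nonneg _ _ _ _ _ _)
      (by split_ifs <;> norm_num)

theorem rewardModel_eq_stepExpectation (M : FiniteMDP S A) (o : MDPOption S A)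
    (h : ∀ s, FiniteExpectedDuration M o s) (s : S) :
    rewardModel M o s = stepExpectation M o s fun s' r =>
      r + (1 - o.termination s') * rewardModel M o s' := by
  -- The first reward v is added with weight 1, the total mass of the executions: this uses almost
  -- sure termination.
  refine (hasSum_optionTransitionProb_mul M o s (fun z => z.2.1)
    (fun s' v => rewardModel M o s' + 1 * v) fun s' v => ?_).tsum_eq.trans ?_
  · simp only [mul_add]
    exact (summable_rewardModel M o s' (h s')).hasSum.add ((h s').1.mul_right v)
  · congr 1; ext s' r; ring

theorem durationModel_eq_stepExpectation (M : FiniteMDP S A) (o : MDPOption S A)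
    (h : ∀ s, FiniteExpectedDuration M o s) (s : S) :
    durationModel M o s = stepExpectation M o s fun s' _ =>
      1 + (1 - o.termination s') * durationModel M o s' := by
  refine (hasSum_optionTransitionProb_mul M o s (fun z => (z.2.2 : ℝ))
    (fun s' _ => durationModel M o s' + 1 * 1) fun s' v => ?_).tsum_eq.trans ?_
  · simp only [Nat.cast_add, Nat.cast_one, mul_add]
    exact (h s').2.hasSum.add ((h s').1.mul_right 1)
  · congr 1; ext s' r; push_cast; ring

theorem durationModel_nonneg (M : FiniteMDP S A) (o : MDPOption S A) (s : S) :
    0 ≤ durationModel M o s :=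
  tsum_nonneg fun _ => mul_nonneg (optionTransitionProb_nonneg _ _ _ _ _ _) (Nat.cast_nonneg _)

theorem one_le_durationModel (M : FiniteMDP S A) (o : MDPOption S A)
    (h : ∀ s, FiniteExpectedDuration M o s) (s : S) : 1 ≤ durationModel M o s := by
  rw [durationModel_eq_stepExpectation M o h]
  conv_lhs => rw [← stepExpectation_const M o s 1]
  refine stepExpectation_mono M o s fun s' _ => ?_
  have := mul_nonneg (sub_nonneg.2 (o.termination_le_one s')) (durationModel_nonneg M o s')
  linarith

theorem stepExpectation_continue_durationModel (M : FiniteMDP S A) (o : MDPOption S A)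
    (h : ∀ s, FiniteExpectedDuration M o s) (s : S) :
    stepExpectation M o s (fun s' _ => (1 - o.termination s') * durationModel M o s')
      = durationModel M o s - 1 := by
  have h1 := durationModel_eq_stepExpectation M o h s
  rw [stepExpectation_add M o s (fun _ _ => 1), stepExpectation_const] at h1
  linarith

/-- The expected value at continuation contracts the sup norm weighted by expected durations. -/
theorem abs_stepExpectation_continue_le (M : FiniteMDP S A) (o : MDPOption S A)
    (h : ∀ s, FiniteExpectedDuration M o s) (f : S → ℝ) (s : S) :
    |stepExpectation M o s fun s' _ => (1 - o.termination s') * (durationModel M o s' * f s')|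
      ≤ (1 - (1 + ∑ s', durationModel M o s')⁻¹) * ‖f‖ * durationModel M o s := by
  have hW : durationModel M o s ≤ 1 + ∑ s', durationModel M o s' := by
    have := Finset.single_le_sum (f := fun s' => durationModel M o s')
      (fun s' _ => durationModel_nonneg M o s') (Finset.mem_univ s)
    linarith
  have hpos : 0 < 1 + ∑ s', durationModel M o s' :=
    lt_of_lt_of_le (by linarith [one_le_durationModel M o h s]) hW
  -- The drop by 1 is turned into a uniform factor, since every duration is at most 1 plus the sum
  -- of all of them.
  have h1 : durationModel M o s - 1
      ≤ (1 - (1 + ∑ s', durationModel M o s')⁻¹) * durationModel M o s := by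
    have h2 : (1 + ∑ s', durationModel M o s')⁻¹ * durationModel M o s ≤ 1 := by
      rw [inv_mul_le_iff₀ hpos]; linarith
    linarith
  calc _ ≤ _ := abs_stepExpectation_le _ _ _ _
    _ ≤ stepExpectation M o s fun s' _ =>
        ‖f‖ * ((1 - o.termination s') * durationModel M o s') := by
      refine stepExpectation_mono M o s fun s' _ => ?_
      have h3 : 0 ≤ (1 - o.termination s') * durationModel M o s' :=
        mul_nonneg (sub_nonneg.2 (o.termination_le_one s')) (durationModel_nonneg M o s')
      rw [← mul_assoc, abs_mul, abs_of_nonneg h3, mul_comm]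
      exact mul_le_mul_of_nonneg_right (norm_le_pi_norm f s') h3
    _ = ‖f‖ * (durationModel M o s - 1) := by
      rw [stepExpectation_const_mul, stepExpectation_continue_durationModel M o h]
    _ ≤ _ := by
      rw [mul_right_comm, mul_comm]
      exact mul_le_mul_of_nonneg_right h1 (norm_nonneg f)

end OptionRecursion

/-! ### Running maximum, measurability and the transition law -/

section RunningMax

/-- The running maximum of `1, f 0, f 1, …`. -/
def runningMax (f : ℕ → ℝ) : ℕ → ℝ
  | 0 => max 1 (f 0)
  | t + 1 => max (runningMax f t) (f (t + 1))

theorem monotone_runningMax (f : ℕ → ℝ) : Monotone (runningMax f) :=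
  monotone_nat_of_le_succ fun _ => le_max_left _ _

theorem one_le_runningMax (f : ℕ → ℝ) (t : ℕ) : 1 ≤ runningMax f t :=
  (le_max_left _ _).trans (monotone_runningMax f t.zero_le)

theorem le_runningMax (f : ℕ → ℝ) (t : ℕ) : f t ≤ runningMax f t := by
  cases t <;> exact le_max_right _ _

end RunningMax

section Measurability

variable {Ω T : Type*} [Finite T]

theorem measurable_comp_of_finite {m : MeasurableSpace Ω} {X : Ω → T} (hX : Measurable[m, ⊤] X)
    {F : T → Ω → ℝ} (hF : ∀ x, Measurable[m] (F x)) : Measurable[m] fun ω => F (X ω) ω := by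
  intro U hU
  have h : (fun ω => F (X ω) ω) ⁻¹' U = ⋃ x, X ⁻¹' {x} ∩ F x ⁻¹' U := by
    ext ω; simp
  rw [h]
  exact MeasurableSet.iUnion fun x => (hX trivial).inter (hF x hU)

theorem measurable_runningMax {m0 : MeasurableSpace Ω} {ℱ : Filtration ℕ m0} {f : ℕ → Ω → ℝ}
    (hf : ∀ t, Measurable[ℱ t] (f t)) (t : ℕ) :
    Measurable[ℱ t] fun ω => runningMax (fun t => f t ω) t := by
  induction t with
  | zero => exact measurable_const.max (hf 0)
  | succ t ih => exact (ih.mono (ℱ.mono t.le_succ) le_rfl).max (hf (t + 1))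

end Measurability

-- For fixed x the dynamics estimate accumulates the signal "terminated on arrival in x", so one
-- convergence theorem covers all three models.
open Classical in
theorem dynamicsEstimate_eq_cumulantEstimate {S A O : Type*} [Fintype A] (opts : O → MDPOption S A) (α : ℕ → S → O → ℝ)
    (st : ℕ → S) (ot : ℕ → O) (act : ℕ → A) (M₀ : S → S → O → ℝ) (t : ℕ) (x s : S) (o : O) :
    dynamicsEstimate opts α st ot act M₀ t x s o
      = cumulantEstimate opts α st ot act
        (fun t => (opts o).termination (st t) * (if st t = x then 1 else 0)) (M₀ x) t s o := by
  induction t generalizing s with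
  | zero => rfl
  | succ t ih => simp only [dynamicsEstimate, cumulantEstimate, ih]

theorem MDPOption.policy_le_one {S A : Type*} [Fintype A] (o : MDPOption S A) (a : A) (s : S) : o.policy a s ≤ 1 :=
  (o.policy_sum s) ▸ Finset.single_le_sum (f := fun a => o.policy a s)
    (fun a _ => o.policy_nonneg a s) (Finset.mem_univ a)

theorem FiniteMDP.p_le_one {S A : Type*} [Fintype S] (M : FiniteMDP S A) (s' : S) (r : M.rewards) (s : S) (a : A) :
    M.p s' r s a ≤ 1 := by
  rw [← M.p_sum s a]
  refine (Finset.single_le_sum (f := fun r => M.p s' r s a) (fun r _ => M.p_nonneg _ _ _ _)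
    (Finset.mem_univ r)).trans ?_
  exact Finset.single_le_sum (f := fun s' => ∑ r, M.p s' r s a)
    (fun s' _ => Finset.sum_nonneg fun r _ => M.p_nonneg _ _ _ _) (Finset.mem_univ s')

theorem transitionProb_mem_Icc {S A : Type*} [Fintype S] [Fintype A] (M : FiniteMDP S A) (o : MDPOption S A) (a : A) (s' : S)
    (r : M.rewards) (s : S) : o.policy a s * M.p s' r s a ∈ Set.Icc (0 : ℝ) 1 :=
  ⟨mul_nonneg (o.policy_nonneg _ _) (M.p_nonneg _ _ _ _),
    mul_le_one₀ (o.policy_le_one _ _) (M.p_nonneg _ _ _ _) (M.p_le_one _ _ _ _)⟩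

/-- Writes any function of the observed triple as a combination of indicators, reducing the noise to
finitely many bounded scalar martingale differences. -/
theorem sum_mul_indicator_transition {S A Ω : Type*} [Fintype S] [Fintype A] {M : FiniteMDP S A}
    {St : ℕ → Ω → S} {At : ℕ → Ω → A} {Rt : ℕ → Ω → ℝ} (t : ℕ) {ω : Ω} (hR : Rt (t + 1) ω ∈ M.rewards)
    (F : A → S → ℝ → ℝ) :
    ∑ a, ∑ s', ∑ r : M.rewards, F a s' r *
        Set.indicator {ω | At t ω = a ∧ St (t + 1) ω = s' ∧ Rt (t + 1) ω = (r : ℝ)}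
          (fun _ => (1 : ℝ)) ω
      = F (At t ω) (St (t + 1) ω) (Rt (t + 1) ω) := by
  classical
  rw [Finset.sum_eq_single (At t ω) (fun a _ ha => by simp [ha.symm]) (by simp),
    Finset.sum_eq_single (St (t + 1) ω) (fun s _ hs => by simp [hs.symm]) (by simp),
    Finset.sum_eq_single ⟨Rt (t + 1) ω, hR⟩
      (fun r _ hr => by
        have : Rt (t + 1) ω ≠ r := fun h => hr (Subtype.ext h.symm)
        simp [this]) (by simp)]
  simp

section Estimates

variable {S A O Ω : Type*} [Fintype S] [Fintype A] [MeasurableSpace Ω]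
  {P : Measure Ω} {ℱ : Filtration ℕ (inferInstance : MeasurableSpace Ω)}
  {M : FiniteMDP S A} {opts : O → MDPOption S A}
  {St : ℕ → Ω → S} {Ot : ℕ → Ω → O} {At : ℕ → Ω → A} {Rt : ℕ → Ω → ℝ}

theorem IsExperience.measurableSet_transition (hexp : IsExperience P ℱ M opts St Ot At Rt)
    (t : ℕ) (a : A) (s' : S) (r : ℝ) :
    MeasurableSet[ℱ (t + 1)] {ω | At t ω = a ∧ St (t + 1) ω = s' ∧ Rt (t + 1) ω = r} :=
  MeasurableSet.inter (hexp.measurable_action t (show MeasurableSet[⊤] {a} from trivial))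
    (MeasurableSet.inter (hexp.measurable_state (t + 1)
      (show MeasurableSet[⊤] {s'} from trivial))
      (hexp.measurable_reward t (measurableSet_singleton r)))

theorem IsExperience.integrable_indicator [IsProbabilityMeasure P]
    (hexp : IsExperience P ℱ M opts St Ot At Rt) (t : ℕ) (a : A) (s' : S) (r : ℝ) :
    Integrable (Set.indicator {ω | At t ω = a ∧ St (t + 1) ω = s' ∧ Rt (t + 1) ω = r}
        (fun _ => (1 : ℝ))) P :=
  (integrable_const 1).indicator (ℱ.le _ _ (hexp.measurableSet_transition t a s' r))

variable [Fintype O]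

theorem IsExperience.measurable_transitionProb (hexp : IsExperience P ℱ M opts St Ot At Rt)
    (t : ℕ) (a : A) (s' : S) (r : M.rewards) :
    Measurable[ℱ t] fun ω => (opts (Ot t ω)).policy a (St t ω) * M.p s' r (St t ω) a :=
  measurable_comp_of_finite (hexp.measurable_state t)
    (F := fun s ω => (opts (Ot t ω)).policy a s * M.p s' r s a) fun s =>
      measurable_comp_of_finite (hexp.measurable_option t)
        (F := fun o _ => (opts o).policy a s * M.p s' r s a) fun _ => measurable_const

theorem IsExperience.integrable_transitionProb [IsProbabilityMeasure P]
    (hexp : IsExperience P ℱ M opts St Ot At Rt) (t : ℕ) (a : A) (s' : S) (r : M.rewards) :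
    Integrable (fun ω => (opts (Ot t ω)).policy a (St t ω) * M.p s' r (St t ω) a) P :=
  integrable_of_measurable_of_abs_le
    ((hexp.measurable_transitionProb t a s' r).mono (ℱ.le _) le_rfl) (C := 1) fun ω => by
      have := transitionProb_mem_Icc M (opts (Ot t ω)) a s' r (St t ω)
      rw [abs_of_nonneg this.1]; exact this.2

theorem IsExperience.condExp_indicator_sub [IsProbabilityMeasure P]
    (hexp : IsExperience P ℱ M opts St Ot At Rt) (t : ℕ) (a : A) (s' : S) (r : M.rewards) :
    P[fun ω => Set.indicator {ω | At t ω = a ∧ St (t + 1) ω = s' ∧ Rt (t + 1) ω = (r : ℝ)}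
        (fun _ => (1 : ℝ)) ω - (opts (Ot t ω)).policy a (St t ω) * M.p s' r (St t ω) a | ℱ t]
      =ᵐ[P] 0 := by
  have h1 := condExp_sub (m := ℱ t) (hexp.integrable_indicator t a s' (r : ℝ))
    (hexp.integrable_transitionProb t a s' r)
  have h2 := condExp_of_stronglyMeasurable (ℱ.le t)
    (hexp.measurable_transitionProb t a s' r).stronglyMeasurable
    (hexp.integrable_transitionProb t a s' r)
  rw [h2] at h1
  refine h1.trans ?_
  filter_upwards [hexp.transition t a s' r] with ω h
  rw [Pi.sub_apply, h]; simp

/-- The prescribed conditional probabilities of triples with reward in `M.rewards` already sum to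
one, leaving no mass for other rewards. -/
theorem IsExperience.ae_reward_mem [IsProbabilityMeasure P]
    (hexp : IsExperience P ℱ M opts St Ot At Rt) (t : ℕ) :
    ∀ᵐ ω ∂P, Rt (t + 1) ω ∈ M.rewards := by
  set I : A → S → M.rewards → Ω → ℝ := fun a s' r =>
    Set.indicator {ω | At t ω = a ∧ St (t + 1) ω = s' ∧ Rt (t + 1) ω = (r : ℝ)}
          (fun _ => (1 : ℝ)) with hI
  have hint : ∀ a s' r, ∫ ω, I a s' r ω ∂P
      = ∫ ω, (opts (Ot t ω)).policy a (St t ω) * M.p s' r (St t ω) a ∂P := fun a s' r => by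
    rw [← integral_condExp (ℱ.le t)]
    exact integral_congr_ae (hexp.transition t a s' r)
  have hU : MeasurableSet {ω | Rt (t + 1) ω ∈ M.rewards} :=
    ((hexp.measurable_reward t).mono (ℱ.le _) le_rfl) M.rewards.measurableSet
  have hsum : ∀ ω, ∑ a, ∑ s', ∑ r, I a s' r ω
      = Set.indicator {ω | Rt (t + 1) ω ∈ M.rewards} (fun _ => (1 : ℝ)) ω := fun ω => by
    by_cases h : Rt (t + 1) ω ∈ M.rewards
    · have := sum_mul_indicator_transition (St := St) (At := At) t h fun _ _ _ => 1
      simp only [one_mul] at this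
      rw [Set.indicator_of_mem (show ω ∈ {ω | Rt (t + 1) ω ∈ M.rewards} from h)]
      exact this
    · rw [Set.indicator_of_notMem (show ω ∉ {ω | Rt (t + 1) ω ∈ M.rewards} from h)]
      refine Finset.sum_eq_zero fun a _ => Finset.sum_eq_zero fun s' _ =>
        Finset.sum_eq_zero fun r _ => Set.indicator_of_notMem (fun hr => h ?_) _
      rw [hr.2.2]; exact r.2
  have h1 : P.real {ω | Rt (t + 1) ω ∈ M.rewards} = 1 := by
    have hIi : ∀ a s' r, Integrable (I a s' r) P := fun a s' r =>
      hexp.integrable_indicator t a s' r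
    have hqi := hexp.integrable_transitionProb t
    rw [← integral_indicator_one hU]
    change ∫ ω, Set.indicator {ω | Rt (t + 1) ω ∈ M.rewards} (fun _ => (1 : ℝ)) ω ∂P = 1
    simp only [← hsum]
    rw [integral_finsetSum _ fun a _ => integrable_finsetSum _ fun s' _ =>
      integrable_finsetSum _ fun r _ => hIi a s' r]
    have h2 : ∀ ω, ∑ a, ∑ s', ∑ r : M.rewards,
        (opts (Ot t ω)).policy a (St t ω) * M.p s' r (St t ω) a = 1 := fun ω => by
      simpa [stepExpectation] using stepExpectation_const M (opts (Ot t ω)) (St t ω) 1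
    have h3 : ∫ ω, ∑ a, ∑ s', ∑ r : M.rewards,
        (opts (Ot t ω)).policy a (St t ω) * M.p s' r (St t ω) a ∂P = 1 := by
      simp only [h2]
      simp
    rw [integral_finsetSum _ fun a _ => integrable_finsetSum _ fun s' _ =>
      integrable_finsetSum _ fun r _ => hqi a s' r] at h3
    rw [← h3]
    refine Finset.sum_congr rfl fun a _ => ?_
    rw [integral_finsetSum _ fun s' _ => integrable_finsetSum _ fun r _ => hIi a s' r,
      integral_finsetSum _ fun s' _ => integrable_finsetSum _ fun r _ => hqi a s' r]
    refine Finset.sum_congr rfl fun s' _ => ?_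
    rw [integral_finsetSum _ fun r _ => hIi a s' r, integral_finsetSum _ fun r _ => hqi a s' r]
    exact Finset.sum_congr rfl fun r _ => hint a s' r
  rw [measureReal_def, ENNReal.toReal_eq_one_iff] at h1
  exact (mem_ae_iff_prob_eq_one hU).2 h1

theorem IsExperience.measurable_cumulantEstimate (hexp : IsExperience P ℱ M opts St Ot At Rt)
    {α : ℕ → S → O → Ω → ℝ} (hα : ∀ t s o, Measurable[ℱ t] (α t s o))
    {c : ℕ → Ω → ℝ} (hc : ∀ t, Measurable[ℱ (t + 1)] (c (t + 1))) (M₀ : S → O → ℝ)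
    (t : ℕ) (s : S) (o : O) :
    Measurable[ℱ t] fun ω => cumulantEstimate opts (fun t s o => α t s o ω) (fun t => St t ω)
      (fun t => Ot t ω) (fun t => At t ω) (fun t => c t ω) M₀ t s o := by
  classical
  induction t generalizing s with
  | zero => exact measurable_const
  | succ t ih =>
    set X : S → Ω → ℝ := fun s ω => cumulantEstimate opts (fun t s o => α t s o ω)
      (fun t => St t ω) (fun t => Ot t ω) (fun t => At t ω) (fun t => c t ω) M₀ t s o with hX
    have hle := ℱ.mono t.le_succ
    have hXm : ∀ s, Measurable[ℱ (t + 1)] (X s) := fun s => (ih s).mono hle le_rfl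
    have h : (fun ω => cumulantEstimate opts (fun t s o => α t s o ω) (fun t => St t ω)
        (fun t => Ot t ω) (fun t => At t ω) (fun t => c t ω) M₀ (t + 1) s o)
        = fun ω => if s = St t ω then X s ω + α t s o ω * importanceRatio opts (At t ω) s o (Ot t ω)
          * (c (t + 1) ω + (1 - (opts o).termination (St (t + 1) ω)) * X (St (t + 1) ω) ω - X s ω)
          else X s ω := by
      ext ω; simp only [cumulantEstimate, hX]
    rw [h]
    refine measurable_comp_of_finite ((hexp.measurable_state t).mono hle le_rfl)
      (F := fun y ω => if s = y then X s ω + α t s o ω * importanceRatio opts (At t ω) s o (Ot t ω)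
          * (c (t + 1) ω + (1 - (opts o).termination (St (t + 1) ω)) * X (St (t + 1) ω) ω - X s ω)
          else X s ω) fun y => ?_
    by_cases hy : s = y
    · simp only [hy, if_true]
      refine (hXm _).add ((((hα _ _ _).mono hle le_rfl).mul ?_).mul (((hc t).add ?_).sub (hXm _)))
      · exact measurable_comp_of_finite (hexp.measurable_action t)
          (F := fun a ω => importanceRatio opts a y o (Ot t ω)) fun a =>
            measurable_comp_of_finite ((hexp.measurable_option t).mono hle le_rfl)
              (F := fun o' _ => importanceRatio opts a y o o') fun _ => measurable_const
      · exact measurable_comp_of_finite (hexp.measurable_state (t + 1))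
          (F := fun x ω => (1 - (opts o).termination x) * X x ω) fun x => (hXm x).const_mul _
    · simpa only [hy, if_false] using hXm s

end Estimates

/-! ### Convergence of the general cumulant estimate -/

section Convergence

theorem importanceRatio_mul_policy {S A O : Type*} [Fintype A] (opts : O → MDPOption S A) (a : A)
    (s : S) (o o' : O) (h : (opts o').policy a s = 0 → (opts o).policy a s = 0) :
    importanceRatio opts a s o o' * (opts o').policy a s = (opts o).policy a s :=
  div_mul_cancel_of_imp h

variable {S A O Ω : Type*} [Fintype S] [Fintype A] [Fintype O] [MeasurableSpace Ω]
  {P : Measure Ω} [IsProbabilityMeasure P]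
  {ℱ : Filtration ℕ (inferInstance : MeasurableSpace Ω)}
  {M : FiniteMDP S A} {opts : O → MDPOption S A}
  {St : ℕ → Ω → S} {Ot : ℕ → Ω → O} {At : ℕ → Ω → A} {Rt : ℕ → Ω → ℝ}

/-- The estimates of the expected total of a signal `c t = G (S_t) (R_t)` converge to the solution
`m` of the Bellman equation. -/
theorem IsExperience.ae_tendsto_cumulantEstimate (hexp : IsExperience P ℱ M opts St Ot At Rt)
    (o : O) (hfinite : ∀ s, FiniteExpectedDuration M (opts o) s)
    {α : ℕ → S → O → Ω → ℝ}
    (hα_adapted : ∀ t s o, Measurable[ℱ t] (α t s o))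
    (hα_mem : ∀ t s o, ∀ᵐ ω ∂P, α t s o ω ∈ Set.Icc (0 : ℝ) 1)
    (hα_sum : ∀ s o, ∀ᵐ ω ∂P,
      Tendsto (fun n => ∑ t ∈ Finset.range n, α t s o ω) atTop atTop)
    (hα_sq : ∀ s o, ∀ᵐ ω ∂P, Summable fun t => α t s o ω ^ 2)
    (hα_zero : ∀ t s o, ∀ᵐ ω ∂P, s ≠ St t ω → α t s o ω = 0)
    (hcover : ∀ t o, ∀ᵐ ω ∂P, α t (St t ω) o ω ≠ 0 →
      ∀ a, (opts (Ot t ω)).policy a (St t ω) = 0 → (opts o).policy a (St t ω) = 0)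
    {G : S → ℝ → ℝ} (hG : ∀ s, Measurable (G s)) {c : ℕ → Ω → ℝ}
    (hc : ∀ t ω, c t ω = G (St t ω) (Rt t ω)) {m : S → ℝ}
    (hm : ∀ s, m s = stepExpectation M (opts o) s fun s' r =>
      G s' r + (1 - (opts o).termination s') * m s') (M₀ : S → O → ℝ) :
    ∀ᵐ ω ∂P, ∀ s, Tendsto (fun t => cumulantEstimate opts (fun t s o => α t s o ω)
      (fun t => St t ω) (fun t => Ot t ω) (fun t => At t ω) (fun t => c t ω) M₀ t s o)
      atTop (𝓝 (m s)) := by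
  classical
  set β := (opts o).termination with hβ
  set w : S → ℝ := durationModel M (opts o) with hw
  have hw1 : ∀ s, 1 ≤ w s := one_le_durationModel M (opts o) hfinite
  have hw0 : ∀ s, 0 < w s := fun s => one_pos.trans_le (hw1 s)
  set X : ℕ → S → Ω → ℝ := fun t s ω => cumulantEstimate opts (fun t s o => α t s o ω)
    (fun t => St t ω) (fun t => Ot t ω) (fun t => At t ω) (fun t => c t ω) M₀ t s o with hX
  have hcm : ∀ t, Measurable[ℱ (t + 1)] (c (t + 1)) := fun t => by
    rw [show c (t + 1) = fun ω => G (St (t + 1) ω) (Rt (t + 1) ω) from funext (hc _)]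
    exact measurable_comp_of_finite (hexp.measurable_state (t + 1))
      (F := fun s ω => G s (Rt (t + 1) ω)) fun s => (hG s).comp (hexp.measurable_reward t)
  have hXm : ∀ t s, Measurable[ℱ t] (X t s) := fun t s =>
    hexp.measurable_cumulantEstimate hα_adapted hcm M₀ t s o
  have hXstep : ∀ t s ω, X (t + 1) s ω = if s = St t ω then
      X t s ω + α t s o ω * importanceRatio opts (At t ω) s o (Ot t ω) *
        (G (St (t + 1) ω) (Rt (t + 1) ω) + (1 - β (St (t + 1) ω)) * X t (St (t + 1) ω) ω - X t s ω)
      else X t s ω := fun t s ω => by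
    simp only [hX, cumulantEstimate, ← hc]; rfl
  set f : Ω → ℕ → S → ℝ := fun ω t s => (X t s ω - m s) / w s with hf
  have hXf : ∀ t s ω, X t s ω = m s + w s * f ω t s := fun t s ω => by
    simp only [hf]; rw [mul_div_cancel₀ _ (hw0 s).ne']; ring
  have hfm : ∀ t, Measurable[ℱ t] fun ω => ‖f ω t‖ := fun t => by
    have h1 : Measurable[ℱ t] fun ω => f ω t :=
      @measurable_pi_lambda _ _ _ (ℱ t) _ _ fun s => ((hXm t s).sub_const _).div_const _
    exact measurable_norm.comp h1
  -- Starting the maximum at 1 permits division by B and lets B dominate the fixed terms |G|, |m|; B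
  -- t depends only on the past.
  set B : ℕ → Ω → ℝ := fun t ω => runningMax (fun t => ‖f ω t‖) t with hB
  have hBm : ∀ t, Measurable[ℱ t] (B t) := measurable_runningMax hfm
  have hB1 : ∀ t ω, 1 ≤ B t ω := fun t ω => one_le_runningMax _ t
  have hB0 : ∀ t ω, 0 < B t ω := fun t ω => one_pos.trans_le (hB1 t ω)
  have hfB : ∀ t s ω, |f ω t s| ≤ B t ω := fun t s ω =>
    (norm_le_pi_norm (f ω t) s).trans (le_runningMax (fun t => ‖f ω t‖) t)
  set δ : ℕ → S → Ω → S → ℝ → ℝ := fun t s ω s' r =>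
    G s' r + (1 - β s') * X t s' ω - X t s ω with hδ
  -- The weighted update that the triple (a, s', r) would cause, divided by B: a predictable
  -- coefficient for the centred indicator ξ of that triple.
  set k : S → A → S → M.rewards → ℕ → Ω → ℝ := fun s a s' r t ω =>
    (if s = St t ω then α t s o ω else 0) * importanceRatio opts a s o (Ot t ω) * δ t s ω s' r
      / (B t ω * w s) with hk
  set ξ : A → S → M.rewards → ℕ → Ω → ℝ := fun a s' r t ω =>
    Set.indicator {ω | At t ω = a ∧ St (t + 1) ω = s' ∧ Rt (t + 1) ω = (r : ℝ)}
        (fun _ => (1 : ℝ)) ω - (opts (Ot t ω)).policy a (St t ω) * M.p s' r (St t ω) a with hξ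
  have hkm : ∀ s a s' r t, Measurable[ℱ t] (k s a s' r t) := fun s a s' r t => by
    refine Measurable.div (Measurable.mul (Measurable.mul ?_ ?_) ?_) ((hBm t).mul_const _)
    · exact measurable_comp_of_finite (hexp.measurable_state t)
        (F := fun y ω => if s = y then α t s o ω else 0) fun y => by
          by_cases hy : s = y
          · simpa only [hy, if_true] using hα_adapted t y o
          · simpa only [hy, if_false] using measurable_const
    · exact measurable_comp_of_finite (hexp.measurable_option t)
        (F := fun o' _ => importanceRatio opts a s o o') fun _ => measurable_const
    · exact (((hXm t s').const_mul _).const_add _).sub (hXm t s)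
  -- The temporal-difference error grows at most linearly in B, which the normalisation cancels;
  -- square summability of α thus passes to k.
  have hkb : ∀ s a s' r, ∃ C, ∀ t ω, |k s a s' r t ω| ≤ C * |α t s o ω| := fun s a s' r => by
    refine ⟨(∑ o', |importanceRatio opts a s o o'|) * (|G s' r| + |m s'| + |m s| + w s' + w s),
      fun t ω => ?_⟩
    have h1 : |if s = St t ω then α t s o ω else 0| ≤ |α t s o ω| := by
      split_ifs <;> simp
    have h2 : |importanceRatio opts a s o (Ot t ω)| ≤ ∑ o', |importanceRatio opts a s o o'| :=
      Finset.single_le_sum (f := fun o' => |importanceRatio opts a s o o'|)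
        (fun _ _ => abs_nonneg _) (Finset.mem_univ _)
    have hXb : ∀ y, |X t y ω| ≤ (|m y| + w y) * B t ω := fun y => by
      rw [hXf]
      refine (abs_add_le _ _).trans ?_
      rw [abs_mul, abs_of_pos (hw0 y), add_mul]
      exact add_le_add (le_mul_of_one_le_right (abs_nonneg _) (hB1 t ω))
        (mul_le_mul_of_nonneg_left (hfB t y ω) (hw0 y).le)
    have h3 : |δ t s ω s' r| ≤ (|G s' r| + |m s'| + |m s| + w s' + w s) * B t ω := by
      have h4 : |(1 - β s') * X t s' ω| ≤ |X t s' ω| := by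
        rw [abs_mul]
        refine mul_le_of_le_one_left (abs_nonneg _) ?_
        rw [abs_of_nonneg (sub_nonneg.2 ((opts o).termination_le_one s'))]
        linarith [(opts o).termination_nonneg s']
      have h5 := hXb s
      have h6 := hXb s'
      have h7 : |G s' r| ≤ |G s' r| * B t ω := le_mul_of_one_le_right (abs_nonneg _) (hB1 t ω)
      have h8 := abs_sub (G s' r + (1 - β s') * X t s' ω) (X t s ω)
      have h9 := abs_add_le (G s' r) ((1 - β s') * X t s' ω)
      simp only [hδ]
      linarith
    have hBw : B t ω ≤ B t ω * w s := le_mul_of_one_le_right (hB0 t ω).le (hw1 s)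
    simp only [hk]
    rw [abs_div, abs_mul, abs_mul, abs_of_pos (mul_pos (hB0 t ω) (hw0 s)),
      div_le_iff₀ (mul_pos (hB0 t ω) (hw0 s))]
    have hC0 : 0 ≤ |G s' r| + |m s'| + |m s| + w s' + w s := by
      have := hw0 s; have := hw0 s'; positivity
    calc _ ≤ |α t s o ω| * (∑ o', |importanceRatio opts a s o o'|)
          * ((|G s' r| + |m s'| + |m s| + w s' + w s) * (B t ω * w s)) := by
          refine mul_le_mul (mul_le_mul h1 h2 (abs_nonneg _) (abs_nonneg _))
            (h3.trans (mul_le_mul_of_nonneg_left hBw hC0)) (abs_nonneg _) ?_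
          exact mul_nonneg (abs_nonneg _) (Finset.sum_nonneg fun _ _ => abs_nonneg _)
      _ = _ := by ring
  have hconv : ∀ s a s' r, ∀ᵐ ω ∂P, ∃ l,
      Tendsto (fun n => ∑ t ∈ Finset.range n, k s a s' r t ω * ξ a s' r t ω) atTop (𝓝 l) :=
    fun s a s' r => by
      refine ae_exists_tendsto_of_summable_sq (ℱ := ℱ) (C := 1) (hkm s a s' r) (fun t => ?_)
        (fun t ω => ?_) (fun t => hexp.condExp_indicator_sub t a s' r) ?_
      · exact (measurable_const.indicator (hexp.measurableSet_transition t a s' r)).sub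
          ((hexp.measurable_transitionProb t a s' r).mono (ℱ.mono t.le_succ) le_rfl)
      · have h1 := transitionProb_mem_Icc M (opts (Ot t ω)) a s' r (St t ω)
        simp only [hξ, Set.indicator_apply]
        rw [abs_le]
        split_ifs <;> constructor <;> linarith [h1.1, h1.2]
      · obtain ⟨C, hC⟩ := hkb s a s' r
        filter_upwards [hα_sq s o] with ω h
        refine Summable.of_nonneg_of_le (fun t => sq_nonneg _) (fun t => ?_) (h.mul_left (C ^ 2))
        rw [← mul_pow, ← sq_abs, ← sq_abs (C * _)]
        refine pow_le_pow_left₀ (abs_nonneg _) ((hC t ω).trans ?_) 2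
        rw [abs_mul]
        exact mul_le_mul_of_nonneg_right (le_abs_self C) (abs_nonneg _)
  simp only [← ae_all_iff] at hconv
  filter_upwards [hconv, ae_all_iff.2 fun t => ae_all_iff.2 fun s => hα_mem t s o,
    ae_all_iff.2 fun s => hα_sum s o, ae_all_iff.2 fun t => ae_all_iff.2 fun s => hα_zero t s o,
    ae_all_iff.2 fun t => hcover t o, ae_all_iff.2 fun t => hexp.ae_reward_mem t]
    with ω hconv hmem hsum hzero hcov hrew
  set d : ℕ → S → ℝ := fun t s => ∑ a, ∑ s', ∑ r, k s a s' r t ω * ξ a s' r t ω with hd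
  set h : ℕ → S → ℝ := fun t s =>
    (stepExpectation M (opts o) s fun s' _ => (1 - β s') * (w s' * f ω t s')) / w s with hh
  have hstep : ∀ t s, f ω (t + 1) s
      = (1 - α t s o ω) * f ω t s + α t s o ω * h t s + B t ω * d t s := fun t s => by
    by_cases hs : s = St t ω
    swap
    · have hd0 : d t s = 0 := by simp [hd, hk, hs]
      have hX0 : X (t + 1) s ω = X t s ω := by rw [hXstep, if_neg hs]
      rw [hd0, hzero t s hs]
      simp only [hf, hX0]; ring
    · have hBw : B t ω * w s ≠ 0 := (mul_pos (hB0 t ω) (hw0 s)).ne'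
      -- The Bellman equation for m cancels the signal, leaving only the continuation of the error.
      have hmean : stepExpectation M (opts o) s (δ t s ω) = w s * h t s - w s * f ω t s := by
        have h1 : (fun s' r => δ t s ω s' r) = fun s' r =>
            ((G s' r + (1 - β s') * m s') + (1 - β s') * (w s' * f ω t s')) - X t s ω := by
          funext s' r; simp only [hδ, hXf t s' ω]; ring
        change stepExpectation M (opts o) s (fun s' r => δ t s ω s' r) = _
        rw [h1, stepExpectation_sub M (opts o) s _ fun _ _ => X t s ω, stepExpectation_const,
          stepExpectation_add M (opts o) s _ fun s' _ => (1 - β s') * (w s' * f ω t s'),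
          ← hm s, hXf t s ω]
        have h2 : w s * h t s = stepExpectation M (opts o) s fun s' _ =>
            (1 - β s') * (w s' * f ω t s') := mul_div_cancel₀ _ (hw0 s).ne'
        rw [h2]; ring
      -- The noise is the realised update minus its mean. In the mean, coverage turns ratio times
      -- executed policy into the policy of o; where α vanishes, no coverage is required.
      have hd1 : d t s = k s (At t ω) (St (t + 1) ω) ⟨_, hrew t⟩ t ω
          - α t s o ω * stepExpectation M (opts o) s (δ t s ω) / (B t ω * w s) := by
        have h1 := sum_mul_indicator_transition (St := St) (At := At) t (hrew t) fun a s' r =>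
          (if s = St t ω then α t s o ω else 0) * importanceRatio opts a s o (Ot t ω)
            * δ t s ω s' r / (B t ω * w s)
        simp only [hd, hξ, mul_sub, Finset.sum_sub_distrib]
        refine congrArg₂ _ h1 ?_
        simp only [stepExpectation, Finset.mul_sum, Finset.sum_div]
        refine Finset.sum_congr rfl fun a _ => Finset.sum_congr rfl fun s' _ =>
          Finset.sum_congr rfl fun r _ => ?_
        simp only [hk, ← hs, if_true]
        by_cases hα0 : α t s o ω = 0
        · simp [hα0]
        · rw [← importanceRatio_mul_policy opts a s o (Ot t ω) (by
            have := hcov t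
            rw [← hs] at this
            exact this hα0 a)]
          ring
      have hX1 : X (t + 1) s ω - X t s ω
          = B t ω * w s * k s (At t ω) (St (t + 1) ω) ⟨_, hrew t⟩ t ω := by
        rw [hXstep, if_pos hs]
        simp only [hk, if_pos hs]
        rw [mul_div_cancel₀ _ hBw]; ring
      have hf1 : f ω (t + 1) s = f ω t s
          + B t ω * k s (At t ω) (St (t + 1) ω) ⟨_, hrew t⟩ t ω := by
        have h1 : X (t + 1) s ω - m s = (X t s ω - m s)
          + B t ω * w s * k s (At t ω) (St (t + 1) ω) ⟨_, hrew t⟩ t ω := by rw [← hX1]; ring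
        simp only [hf]
        rw [h1]
        field_simp [(hw0 s).ne']
      rw [hd1, hmean, hf1]
      field_simp [(hw0 s).ne', (hB0 t ω).ne']
      ring
  have hlim : Tendsto (f ω) atTop (𝓝 0) := by
    refine tendsto_zero_of_contracting_targets (α := fun t s => α t s o ω) (h := h) (d := d)
      (B := fun t => B t ω) (γ := 1 - (1 + ∑ s', w s')⁻¹) (fun t s => hmem t s) hsum hstep
      ?_ ?_ (fun t s => ?_) (monotone_runningMax _) (fun t => le_runningMax (fun t => ‖f ω t‖) t)
      (fun t => le_rfl) (fun s => ?_)
    · rw [sub_nonneg]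
      exact inv_le_one_of_one_le₀ (by
        linarith [Finset.sum_nonneg fun s (_ : s ∈ Finset.univ) => (hw0 s).le])
    · have : 0 < 1 + ∑ s', w s' := by
        linarith [Finset.sum_nonneg fun s (_ : s ∈ Finset.univ) => (hw0 s).le]
      linarith [inv_pos.2 this]
    · simp only [hh]
      rw [abs_div, abs_of_pos (hw0 s), div_le_iff₀ (hw0 s)]
      exact abs_stepExpectation_continue_le M (opts o) hfinite (f ω t) s
    · choose l hl using hconv s
      refine ⟨∑ a, ∑ s', ∑ r, l a s' r, ?_⟩
      have h1 := tendsto_finsetSum Finset.univ fun a _ => tendsto_finsetSum Finset.univ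
        fun s' _ => tendsto_finsetSum Finset.univ fun r _ => hl a s' r
      refine h1.congr fun n => ?_
      simp only [hd]
      symm
      rw [Finset.sum_comm]
      refine Finset.sum_congr rfl fun a _ => ?_
      rw [Finset.sum_comm]
      exact Finset.sum_congr rfl fun s' _ => Finset.sum_comm
  intro s
  have h1 := ((tendsto_pi_nhds.1 hlim s).const_mul (w s)).const_add (m s)
  refine Tendsto.congr (fun t => (hXf t s ω).symm) ?_
  simpa using h1

end Convergence

/-! ### The three models as instances -/

theorem theorem5 {S A O Ω : Type*} [Fintype S] [Fintype A] [Fintype O] [MeasurableSpace Ω]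
    (P : Measure Ω) [IsProbabilityMeasure P]
    (ℱ : Filtration ℕ (inferInstance : MeasurableSpace Ω))
    (M : FiniteMDP S A) (opts : O → MDPOption S A)
    -- the expected execution time of every option from every state is finite
    (hfinite : ∀ o s, FiniteExpectedDuration M (opts o) s)
    (St : ℕ → Ω → S) (Ot : ℕ → Ω → O) (At : ℕ → Ω → A) (Rt : ℕ → Ω → ℝ)
    (hexp : IsExperience P ℱ M opts St Ot At Rt)
    -- step sizes, one for each state-option pair
    (α : ℕ → S → O → Ω → ℝ)
    (hα_adapted : ∀ t s o, Measurable[ℱ t] (α t s o))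
    (hα_mem : ∀ t s o, ∀ᵐ ω ∂P, α t s o ω ∈ Set.Icc (0 : ℝ) 1)
    (hα_sum : ∀ s o, ∀ᵐ ω ∂P,
      Tendsto (fun n => ∑ t ∈ Finset.range n, α t s o ω) atTop atTop)
    (hα_sq : ∀ s o, ∀ᵐ ω ∂P, Summable fun t => α t s o ω ^ 2)
    (hα_zero : ∀ t s o, ∀ᵐ ω ∂P, s ≠ St t ω → α t s o ω = 0)
    -- coverage: the executed option may take every action that an updated option may take
    (hcover : ∀ t o, ∀ᵐ ω ∂P, α t (St t ω) o ω ≠ 0 →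
      ∀ a, (opts (Ot t ω)).policy a (St t ω) = 0 → (opts o).policy a (St t ω) = 0)
    -- arbitrary initial estimates
    (Mp₀ : S → S → O → ℝ) (Mr₀ Ml₀ : S → O → ℝ) :
    ∀ᵐ ω ∂P, ∀ s o,
      (∀ x, Tendsto
        (fun t => dynamicsEstimate opts (fun t s o => α t s o ω) (fun t => St t ω)
          (fun t => Ot t ω) (fun t => At t ω) Mp₀ t x s o)
        atTop (𝓝 (dynamicsModel M (opts o) x s))) ∧
      Tendsto
        (fun t => rewardEstimate opts (fun t s o => α t s o ω) (fun t => St t ω)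
          (fun t => Ot t ω) (fun t => At t ω) (fun t => Rt t ω) Mr₀ t s o)
        atTop (𝓝 (rewardModel M (opts o) s)) ∧
      Tendsto
        (fun t => durationEstimate opts (fun t s o => α t s o ω) (fun t => St t ω)
          (fun t => Ot t ω) (fun t => At t ω) Ml₀ t s o)
        atTop (𝓝 (durationModel M (opts o) s)) := by
  classical
  have hdyn : ∀ o x, ∀ᵐ ω ∂P, ∀ s, Tendsto
      (fun t => dynamicsEstimate opts (fun t s o => α t s o ω) (fun t => St t ω)
        (fun t => Ot t ω) (fun t => At t ω) Mp₀ t x s o)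
      atTop (𝓝 (dynamicsModel M (opts o) x s)) := fun o x => by
    simp only [dynamicsEstimate_eq_cumulantEstimate]
    convert hexp.ae_tendsto_cumulantEstimate o (hfinite o) hα_adapted hα_mem hα_sum hα_sq hα_zero
      hcover (G := fun s' _ => (opts o).termination s' * (if s' = x then 1 else 0))
      (fun _ => measurable_const) (fun _ _ => rfl)
      (fun s => dynamicsModel_eq_stepExpectation M (opts o) (hfinite o) x s) (Mp₀ x)
  have hrew : ∀ o, ∀ᵐ ω ∂P, ∀ s, Tendsto
      (fun t => rewardEstimate opts (fun t s o => α t s o ω) (fun t => St t ω)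
        (fun t => Ot t ω) (fun t => At t ω) (fun t => Rt t ω) Mr₀ t s o)
      atTop (𝓝 (rewardModel M (opts o) s)) := fun o =>
    hexp.ae_tendsto_cumulantEstimate o (hfinite o) hα_adapted hα_mem hα_sum hα_sq hα_zero
      hcover (G := fun _ r => r) (fun _ => measurable_id) (fun _ _ => rfl)
      (fun s => rewardModel_eq_stepExpectation M (opts o) (hfinite o) s) Mr₀
  have hdur : ∀ o, ∀ᵐ ω ∂P, ∀ s, Tendsto
      (fun t => durationEstimate opts (fun t s o => α t s o ω) (fun t => St t ω)
        (fun t => Ot t ω) (fun t => At t ω) Ml₀ t s o)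
      atTop (𝓝 (durationModel M (opts o) s)) := fun o =>
    hexp.ae_tendsto_cumulantEstimate o (hfinite o) hα_adapted hα_mem hα_sum hα_sq hα_zero
      hcover (G := fun _ _ => 1) (c := fun _ _ => 1) (fun _ => measurable_const) (fun _ _ => rfl)
      (fun s => durationModel_eq_stepExpectation M (opts o) (hfinite o) s) Ml₀
  filter_upwards [ae_all_iff.2 fun o => ae_all_iff.2 fun x => hdyn o x, ae_all_iff.2 hrew,
    ae_all_iff.2 hdur] with ω h1 h2 h3 s o
  exact ⟨fun x => h1 o x s, h2 o s, h3 o s⟩
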